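/- Let $\Sigma$ be a finite alphabet with at least two symbols. For a map $T:\Sigma^*\to\Sigma^*$ and a sequence $S\in\Sigma^\infty$ put $$\rho_T(S)=\liminf_{n\to\infty}\frac{|T(S[1..n])|}{n},\qquad R_T(S)=\limsup_{n\to\infty}\frac{|T(S[1..n])|}{n}.$$ A visibly pushdown compressor (visiblyPD) is a deterministic pushdown transducer $C=(Q,\Sigma,\Gamma,\delta,\nu,q_0,z_0)$ with finite state set $Q$ and finite stack alphabet $\Gamma$, without $\lambda$-moves, that reads and writes symbols of $\Sigma$ (with $\nu:Q\times\Sigma\times\Gamma\to\Sigma^*$ giving the word written when a symbol is read), is defined on all inputs, and never removes the start symbol $z_0$ from the bottom of the stack, such that (i) $C$ is information-lossless: the map $w\mapsto(C(w),\text{final state of }C\text{ on }w)$ is one-to-one on $\Sigma^*$; (ii) $\Sigma$ can be partitioned into call, return and internal symbols so that $C$ pushes exactly one symbol, different from $z_0$, when it reads a call, pops exactly one symbol when it reads a return (and leaves the stack unchanged if only $z_0$ is on it), and leaves the stack unchanged when it reads an internal symbol. Let $R_{\mathrm{visiblyPD}}(S)=\inf\{R_C(S)\mid C\text{ is a visiblyPD}\}$.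 A plogon transducer is a Turing machine that halts on every input $w\in\Sigma^*$, reads $w$ once from left to right, has $|w|$ written in binary on a special read-only tape, writes its output in $\Sigma^*$ from left to right on a write-only tape, and uses work space polylogarithmic in $|w|$ (at most $(\lfloor\log_2|w|\rfloor+2)^c$ cells for a constant $c$, with $\lfloor\log_2 0\rfloor$ read as $0$). An ILplog is a one-to-one map $\Sigma^*\to\Sigma^*$ computed by a plogon transducer. Let $\rho_{\mathrm{plogon}}(S)=\inf\{\rho_C(S)\mid C\text{ is an ILplog}\}$. Then there exists a sequence $S\in\Sigma^\infty$ such that $$R_{\mathrm{visiblyPD}}(S)\le\frac12\qquad\text{and}\qquad\rho_{\mathrm{plogon}}(S)\ge 1-\frac{1}{\log_2|\Sigma|}.$$ -/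

import Mathlib

open scoped ENNReal

universe u

namespace Compression

/-! ### Sequences and compression ratios

`A` is the alphabet; strings are `List A`, sequences are `ℕ → A`. -/

/-- The prefix of length `n` of the sequence `S`. -/
def pre {A : Type u} (S : ℕ → A) (n : ℕ) : List A := (List.range n).map S

/-- `ρ_T(S) = liminf |T(S[1..n])| / n`, in `[0, ∞]`. -/
noncomputable def lowerRatio {A : Type u} (T : List A → List A) (S : ℕ → A) : ℝ≥0∞ :=
  Filter.liminf (fun n : ℕ => ((T (pre S n)).length : ℝ≥0∞) / (n : ℝ≥0∞)) Filter.atTop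

/-- `R_T(S) = limsup |T(S[1..n])| / n`, in `[0, ∞]`. -/
noncomputable def upperRatio {A : Type u} (T : List A → List A) (S : ℕ → A) : ℝ≥0∞ :=
  Filter.limsup (fun n : ℕ => ((T (pre S n)).length : ℝ≥0∞) / (n : ℝ≥0∞)) Filter.atTop

/-! ### Pushdown compressors -/

/-- A bounded pushdown compressor `(Q, A, Γ, δ, ν, q₀, z₀, c)`. In `δ`, the input letter `none` is
`λ` and the value `none` is "undefined". Stack words have their top on the left. -/
structure BPDC (A : Type u) where
  Q : Type
  Γ : Type
  finiteQ : Finite Q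
  finiteΓ : Finite Γ
  δ : Q → Option A → Γ → Option (Q × List Γ)
  ν : Q → A → Γ → List A
  q₀ : Q
  z₀ : Γ
  c : ℕ
  /-- The start symbol is never removed from the bottom of the stack. -/
  bottom : ∀ q b q' v, δ q b z₀ = some (q', v) → ∃ u, v = u ++ [z₀]
  /-- `λ`-rules only pop the top symbol. -/
  lambda_pop : ∀ q a q' v, δ q none a = some (q', v) → v = []
  deterministic : ∀ q a, δ q none a = none ∨ ∀ b, δ q (some b) a = none

namespace BPDC

variable {A : Type u} (C : BPDC A)

/-- Apply one `λ`-rule if one is applicable. -/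
def lambdaStep : C.Q × List C.Γ → C.Q × List C.Γ
  | (q, []) => (q, [])
  | (q, a :: s) =>
    match C.δ q none a with
    | some (q', v) => (q', v ++ s)
    | none => (q, a :: s)

/-- Apply the applicable `λ`-rules, at most `c` many. (A machine that could apply more of them is
stuck afterwards, by determinism: it is not total.) -/
def settle (x : C.Q × List C.Γ) : C.Q × List C.Γ := C.lambdaStep^[C.c] x

/-- Read the input letter `b`, in a situation that consists of a configuration (state and stack)
and of the output written so far; `none` if the transition is undefined. -/
def step (b : A) : (C.Q × List C.Γ) × List A → Option ((C.Q × List C.Γ) × List A)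
  | ((_, []), _) => none
  | ((q, a :: s), o) =>
    (C.δ q (some b) a).map fun r => (C.settle (r.1, r.2 ++ s), o ++ C.ν q b a)

/-- Configuration reached and output written on the input `w`. -/
def run (w : List A) : Option ((C.Q × List C.Γ) × List A) :=
  w.foldlM (fun x b => C.step b x) (C.settle (C.q₀, [C.z₀]), [])

/-- The output `C(w)` (only used for machines whose run is defined on all inputs). -/
def output (w : List A) : List A := ((C.run w).map Prod.snd).getD []

/-- `C` is defined on all inputs, and `w ↦ (C(w), final state)` is one-to-one. -/
def IsInformationLossless : Prop :=
  (∀ w, (C.run w).isSome) ∧ Function.Injective fun w => (C.run w).map fun x => (x.2, x.1.1)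

end BPDC

/-- The three types of symbols of a visibly pushdown alphabet. -/
inductive SymbolKind where
  | call
  | ret
  | internal

/-- `C` obeys the visibly pushdown discipline for the given partition of the alphabet. The stack
counts as empty when only `z₀` is on it; `z₀` itself is never pushed. -/
structure BPDC.ObeysKinds {A : Type u} (C : BPDC A) (kind : A → SymbolKind) : Prop where
  no_lambda : ∀ q a, C.δ q none a = none
  call : ∀ b, kind b = SymbolKind.call → ∀ q a q' v, C.δ q (some b) a = some (q', v) →
    ∃ g, g ≠ C.z₀ ∧ v = [g, a]
  ret_pop : ∀ b, kind b = SymbolKind.ret → ∀ q a q' v, C.δ q (some b) a = some (q', v) →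
    a ≠ C.z₀ → v = []
  ret_empty : ∀ b, kind b = SymbolKind.ret → ∀ q q' v, C.δ q (some b) C.z₀ = some (q', v) →
    v = [C.z₀]
  internal : ∀ b, kind b = SymbolKind.internal → ∀ q a q' v, C.δ q (some b) a = some (q', v) →
    v = [a]

/-- Visibly pushdown compressors. -/
def BPDC.IsVisiblyPD {A : Type u} (C : BPDC A) : Prop :=
  C.IsInformationLossless ∧ ∃ kind : A → SymbolKind, C.ObeysKinds kind

/-- Worst-case visibly pushdown compression ratio. -/
noncomputable def RVisiblyPD {A : Type u} (S : ℕ → A) : ℝ≥0∞ :=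
  ⨅ C : {C : BPDC A // C.IsVisiblyPD}, upperRatio C.1.output S

/-! ### Polylogarithmic space online compressors -/

/-- Head moves. Tapes are infinite to the right; a left move at the left end has no effect. -/
inductive Move where
  | left
  | stay
  | right

/-- New head position. -/
def Move.apply : Move → ℕ → ℕ
  | left, p => p - 1
  | stay, p => p
  | right, p => p + 1

/-- What a machine does in one step: new state, symbol written on the work tape, moves of the heads
on the work tape and on the length tape, whether the input head moves on to the next input letter,
and the letter (if any) appended to the output. -/
structure Action (A : Type u) (k g : ℕ) where
  next : Fin k
  write : Fin g
  workMove : Move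
  lenMove : Move
  advance : Bool
  emit : Option A

/-- A Turing machine with a one-way read-only input tape, a two-way read-only tape holding the
length of the input in binary, a work tape, and a write-only output tape. The transition depends on
the state, the scanned input letter (`none` at the end of the input), the scanned bit of the length
(`none` at its end) and the scanned work tape symbol; the value `none` means that it halts. -/
structure OnlineTM (A : Type u) where
  numStates : ℕ
  numSymbols : ℕ
  start : Fin numStates
  blank : Fin numSymbols
  δ : Fin numStates → Option A → Option Bool → Fin numSymbols →
    Option (Action A numStates numSymbols)

namespace OnlineTM

/-- Configurations; `input` is the part of the input from the input head on. -/
structure Cfg (A : Type u) (k g : ℕ) where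
  state : Fin k
  input : List A
  lenPos : ℕ
  tape : ℕ → Fin g
  head : ℕ
  output : List A

variable {A : Type u} (M : OnlineTM A)

/-- Initial configuration on the input `w`. -/
def init (w : List A) : Cfg A M.numStates M.numSymbols where
  state := M.start
  input := w
  lenPos := 0
  tape := fun _ => M.blank
  head := 0
  output := []

/-- One step on an input of length `n`. The head on the length tape stays within the bits of `n`
and the first cell after them, so that its position is no extra memory. -/
def step (n : ℕ) (x : Cfg A M.numStates M.numSymbols) :
    Option (Cfg A M.numStates M.numSymbols) :=
  (M.δ x.state x.input.head? (n.bits[x.lenPos]?) (x.tape x.head)).map fun act =>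
    { state := act.next
      input := if act.advance then x.input.tail else x.input
      lenPos := min (act.lenMove.apply x.lenPos) n.bits.length
      tape := Function.update x.tape x.head act.write
      head := act.workMove.apply x.head
      output := x.output ++ act.emit.toList }

/-- `M` halts on every input `w`, with output `f w`. -/
def Computes (f : List A → List A) : Prop :=
  ∀ w, ∃ x, StateTransition.Reaches (M.step w.length) (M.init w) x ∧
    M.step w.length x = none ∧ x.output = f w

/-- The work tape cells visited on an input of length `n` are among the first
`(⌊log₂ n⌋ + 2) ^ e`, for a constant `e`. -/
def PolylogSpace : Prop :=
  ∃ e : ℕ, ∀ w x, StateTransition.Reaches (M.step w.length) (M.init w) x →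
    x.head < (Nat.log 2 w.length + 2) ^ e

end OnlineTM

/-- `f` is an information lossless compressor that is computed by a plogon transducer. -/
def IsILPlog {A : Type u} (f : List A → List A) : Prop :=
  Function.Injective f ∧ ∃ M : OnlineTM A, M.PolylogSpace ∧ M.Computes f

/-- Best-case plogon compression ratio. -/
noncomputable def rhoPlogon {A : Type u} (S : ℕ → A) : ℝ≥0∞ :=
  ⨅ f : {f : List A → List A // IsILPlog f}, lowerRatio f.1 S

end Compression

/-! Let k = |Σ|. Σ is split into ⌊k/2⌋ calls, as many matching returns and, for odd k, one internal
symbol. The sequence is w₀ w̄₀ w₁ w̄₁ …, where wₙ is a suitable opening word of length n and w̄ is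
the reversal of w with calls and returns exchanged.

Upper bound: reading wₙ builds a stack from which w̄ₙ can be predicted letter by letter. An internal
symbol cannot be pushed, so it waits in the finite control and goes onto the stack together with the
call that has to follow it. Copying wₙ and reporting correct predictions only once in v + 1 gives a
ratio of at most 1/2 + 2/(v + 1) (`upperRatio_compressor_le`). Nothing is lost, since the code is
prefix-free and the final state holds the number of unreported predictions
(`Predictor.encode_injective`).

Lower bound: if a machine computes an injective map, a word x of known length inside an input is
determined by the input length, the memories before and after x and the output in between
(`OnlineTM.Computes.eq_of_consumes`). With polylogarithmic memory, only 2^o(j) k^(cj) words of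
length j can be processed with at most cj letters of output. There are at least (2/3)(k/2)^j opening
words, so for c < log_k(k/2) = 1 - 1/log₂ k nearly all of them are incompressible, and so are their
mirror images. There are countably many machines, so a union bound provides words that eventually
defeat each of them (`exists_incompressible`). Both halves of every long block then cost a fraction
c of their length (`le_lowerRatio_mirrorSeq`). -/

namespace Compression

/-! ### Bracket alphabets and opening words -/

/-- A partition of the alphabet into call, return and internal symbols, with an involution that
exchanges the calls with the returns and fixes the internal symbols. -/
structure Brackets (A : Type u) where
  kind : A → SymbolKind
  bar : A → A
  bar_bar : Function.Involutive bar
  bar_call : ∀ a, kind a = SymbolKind.call → kind (bar a) = SymbolKind.ret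
  bar_internal : ∀ a, kind a = SymbolKind.internal → bar a = a

namespace Brackets

/-- The bracket structure with `m` pairs of brackets given by an enumeration of the alphabet. -/
def ofEquiv {A : Type u} {m i : ℕ} (e : A ≃ (Fin m ⊕ Fin m) ⊕ Fin i) : Brackets A where
  kind a := match e a with
    | Sum.inl (Sum.inl _) => SymbolKind.call
    | Sum.inl (Sum.inr _) => SymbolKind.ret
    | Sum.inr _ => SymbolKind.internal
  bar a := e.symm (Sum.map Sum.swap id (e a))
  bar_bar a := by
    rcases h : e a with (x | x) | x <;> simp [Equiv.symm_apply_eq, h]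
  bar_call a ha := by
    rcases h : e a with (x | x) | x <;> simp_all
  bar_internal a ha := by
    rcases h : e a with (x | x) | x <;> simp_all [Equiv.symm_apply_eq]

variable {A : Type u} (B : Brackets A)

/-- The closing counterpart of a word. -/
def mirror (w : List A) : List A := (w.map B.bar).reverse

@[simp] lemma mirror_nil : B.mirror [] = [] := rfl

lemma mirror_cons (a : A) (w : List A) : B.mirror (a :: w) = B.mirror w ++ [B.bar a] := by
  simp [mirror]

@[simp] lemma length_mirror (w : List A) : (B.mirror w).length = w.length := by
  simp [mirror]

lemma mirror_injective : Function.Injective B.mirror :=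
  List.reverse_injective.comp (List.map_injective_iff.2 B.bar_bar.injective)

/-- Words of calls and internal symbols in which every internal symbol is followed by a call. -/
inductive Opening : List A → Prop
  | nil : Opening []
  | call {c : A} {w : List A} : B.kind c = SymbolKind.call → Opening w → Opening (c :: w)
  | internal {h c : A} {w : List A} : B.kind h = SymbolKind.internal →
      B.kind c = SymbolKind.call → Opening w → Opening (h :: c :: w)

/-! ### Growth rate of the opening words -/

section Counting

open Classical in
/-- The opening words of a given length, built from a set `s` of calls and a set `t` of internal
symbols. -/
noncomputable def words (s t : Finset A) : ℕ → Finset (List A)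
  | 0 => {[]}
  | 1 => s.image fun c => [c]
  | n + 2 => ((s ×ˢ words s t (n + 1)).image fun p => p.1 :: p.2) ∪
      ((t ×ˢ s) ×ˢ words s t n).image fun p => p.1.1 :: p.1.2 :: p.2

lemma opening_of_mem_words {s t : Finset A} (hs : ∀ a ∈ s, B.kind a = SymbolKind.call)
    (ht : ∀ a ∈ t, B.kind a = SymbolKind.internal) :
    ∀ (n : ℕ) (w : List A), w ∈ words s t n → B.Opening w ∧ w.length = n
  | 0, w, hw => by
    classical
    simp only [words, Finset.mem_singleton] at hw
    exact hw ▸ ⟨.nil, rfl⟩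
  | 1, w, hw => by
    classical
    simp only [words, Finset.mem_image] at hw
    obtain ⟨c, hc, rfl⟩ := hw
    exact ⟨.call (hs c hc) .nil, rfl⟩
  | n + 2, w, hw => by
    classical
    simp only [words, Finset.mem_union, Finset.mem_image, Finset.mem_product] at hw
    rcases hw with ⟨⟨c, w⟩, ⟨hc, hw⟩, rfl⟩ | ⟨⟨⟨h, c⟩, w⟩, ⟨⟨hh, hc⟩, hw⟩, rfl⟩
    · obtain ⟨h1, h2⟩ := opening_of_mem_words hs ht (n + 1) w hw
      exact ⟨.call (hs c hc) h1, by simp [h2]⟩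
    · obtain ⟨h1, h2⟩ := opening_of_mem_words hs ht n w hw
      exact ⟨.internal (ht h hh) (hs c hc) h1, by simp [h2]⟩

lemma card_words_add_two {s t : Finset A} (hst : Disjoint s t) (n : ℕ) :
    (words s t (n + 2)).card =
      s.card * (words s t (n + 1)).card + t.card * s.card * (words s t n).card := by
  classical
  rw [words, Finset.card_union_of_disjoint, Finset.card_image_of_injective,
    Finset.card_image_of_injective, Finset.card_product, Finset.card_product, Finset.card_product]
  · rintro ⟨⟨a, b⟩, c⟩ ⟨⟨a', b'⟩, c'⟩ h
    simp_all
  · rintro ⟨a, b⟩ ⟨a', b'⟩ h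
    simp_all
  · rw [Finset.disjoint_left]
    simp only [Finset.mem_image, Finset.mem_product]
    rintro _ ⟨⟨c, w⟩, ⟨hc, hw⟩, rfl⟩ ⟨⟨⟨h, c'⟩, w'⟩, ⟨⟨hh, hc'⟩, hw'⟩, he⟩
    simp only [List.cons.injEq] at he
    exact Finset.disjoint_left.1 hst hc (he.1 ▸ hh)

/-- With `m` calls and `i ≤ 1` internal symbols, the opening words of length `n` number at least
`(2 / 3) (m + i / 2) ^ n`. -/
lemma le_card_words {s t : Finset A} (hst : Disjoint s t) (hs : 1 ≤ s.card) (ht : t.card ≤ 1) :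
    ∀ n, (2 / 3 : ℝ) * ((s.card : ℝ) + t.card / 2) ^ n ≤ (words s t n).card
  | 0 => by norm_num [words]
  | 1 => by
    have : (words s t 1).card = s.card := by
      classical
      rw [words, Finset.card_image_of_injective]
      intro a b h
      simpa using h
    have hs' : (1 : ℝ) ≤ s.card := by exact_mod_cast hs
    have ht' : (t.card : ℝ) ≤ 1 := by exact_mod_cast ht
    rw [this]
    -- The length 1 forces the constant 2/3: it is sharp for one call and one internal symbol.
    linarith
  | n + 2 => by
    have h0 := le_card_words hst hs ht n
    have h1 := le_card_words hst hs ht (n + 1)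
    have hs' : (1 : ℝ) ≤ s.card := by exact_mod_cast hs
    have ht' : (t.card : ℝ) ≤ 1 := by exact_mod_cast ht
    have ht0 : (0 : ℝ) ≤ t.card := by positivity
    rw [card_words_add_two hst]
    push_cast
    set x : ℝ := (s.card : ℝ)
    set y : ℝ := (t.card : ℝ)
    set z : ℝ := x + y / 2
    -- The difference of the two sides is y(2x - y)/4, and y ≤ 1 ≤ x. So z is at most the growth
    -- rate of the recurrence.
    have hz : z ^ 2 ≤ x * z + y * x := by
      simp only [z]
      nlinarith [mul_nonneg ht0 (sub_nonneg.2 hs'), mul_nonneg ht0 (sub_nonneg.2 ht')]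
    have hzn : 0 ≤ z ^ n := by positivity
    calc (2 / 3 : ℝ) * z ^ (n + 2) = 2 / 3 * z ^ n * z ^ 2 := by ring
      _ ≤ 2 / 3 * z ^ n * (x * z + y * x) := by gcongr
      _ = x * (2 / 3 * z ^ (n + 1)) + y * x * (2 / 3 * z ^ n) := by ring
      _ ≤ _ := by gcongr

/-- Every alphabet with at least two letters has a bracket structure with at least
`(2 / 3) (|A| / 2) ^ n` opening words of length `n`. -/
lemma exists_many_openings [Fintype A] (hA : 2 ≤ Fintype.card A) :
    ∃ (B : Brackets A) (W : ℕ → Finset (List A)), (∃ c, B.kind c = SymbolKind.call) ∧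
      (∀ n, ∀ w ∈ W n, B.Opening w ∧ w.length = n) ∧
      ∀ n, (2 / 3 : ℝ) * ((Fintype.card A : ℝ) / 2) ^ n ≤ (W n).card := by
  set k := Fintype.card A with hk
  -- For odd k the brackets alone would give only ((k - 1)/2)^n words; the internal symbol makes up
  -- for the missing half.
  have e : A ≃ (Fin (k / 2) ⊕ Fin (k / 2)) ⊕ Fin (k % 2) :=
    Fintype.equivOfCardEq (by simp only [Fintype.card_sum, Fintype.card_fin]; omega)
  let s : Finset A := Finset.univ.map ⟨fun x : Fin (k / 2) => e.symm (Sum.inl (Sum.inl x)),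
    fun x y h => by simpa using h⟩
  let t : Finset A := Finset.univ.map ⟨fun x : Fin (k % 2) => e.symm (Sum.inr x),
    fun x y h => by simpa using h⟩
  have hs : s.card = k / 2 := by simp [s]
  have ht : t.card = k % 2 := by simp [t]
  have hsc : ∀ a ∈ s, (ofEquiv e).kind a = SymbolKind.call := by
    intro a ha
    simp only [s, Finset.mem_map, Finset.mem_univ, true_and] at ha
    obtain ⟨x, rfl⟩ := ha
    have : (ofEquiv e).kind (e.symm (Sum.inl (Sum.inl x))) = SymbolKind.call := by simp [ofEquiv]
    exact this
  have htc : ∀ a ∈ t, (ofEquiv e).kind a = SymbolKind.internal := by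
    intro a ha
    simp only [t, Finset.mem_map, Finset.mem_univ, true_and] at ha
    obtain ⟨x, rfl⟩ := ha
    have : (ofEquiv e).kind (e.symm (Sum.inr x)) = SymbolKind.internal := by simp [ofEquiv]
    exact this
  have hst : Disjoint s t := by
    rw [Finset.disjoint_left]
    intro a h1 h2
    have := (hsc a h1).symm.trans (htc a h2)
    cases this
  obtain ⟨c, hc⟩ : s.Nonempty := Finset.card_pos.1 (by omega)
  refine ⟨ofEquiv e, words s t, ⟨c, hsc c hc⟩, opening_of_mem_words _ hsc htc, fun n => ?_⟩
  have h := le_card_words hst (by omega) (by omega) n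
  have hk2 : (k : ℝ) / 2 = (s.card : ℝ) + t.card / 2 := by
    have : (k : ℝ) = 2 * (s.card : ℝ) + t.card := by
      rw [hs, ht]
      exact_mod_cast (Nat.div_add_mod k 2).symm
    rw [this]
    ring
  rwa [hk2]

end Counting

end Brackets

/-! ### Avoiding countably many rare sets -/

/-- Countably many families of sets, each of which is eventually rare in the nonempty finite sets
`W n`, can be avoided: some `w n ∈ W n` are eventually outside each family. -/
lemma exists_eventually_not_mem {ι : Type*} {α : Type*} [Countable ι] (W : ℕ → Finset α)
    (hW : ∀ n, (W n).Nonempty) (bad : ι → ℕ → Set α)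
    (hbad : ∀ i, ∀ c : ℕ, ∀ᶠ n in Filter.atTop, ((W n : Set α) ∩ bad i n).ncard * c < (W n).card) :
    ∃ w : ℕ → α, (∀ n, w n ∈ W n) ∧ ∀ i, ∀ᶠ n in Filter.atTop, w n ∉ bad i n := by
  classical
  obtain ⟨g, hg⟩ := exists_injective_nat ι
  -- From `N i` on, family i takes up less than a share 2^-(g i + 1) of `W n`. At stage n only the
  -- families with `g i < n` count, and their shares add up to at most 1 - 2^-n.
  choose N hN using fun i => Filter.eventually_atTop.1 (hbad i (2 ^ (g i + 1)))
  have key : ∀ n, ∃ x ∈ W n, ∀ i, N i ≤ n → g i < n → x ∉ bad i n := by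
    intro n
    by_contra! hcon
    have hfin : {i | g i < n}.Finite := (Set.finite_lt_nat n).preimage hg.injOn
    let I : Finset ι := hfin.toFinset.filter fun i => N i ≤ n
    have hsub : W n ⊆ I.biUnion fun i => (W n).filter fun x => x ∈ bad i n := by
      intro x hx
      obtain ⟨i, h1, h2, h3⟩ := hcon x hx
      simp only [Finset.mem_biUnion, Finset.mem_filter, I, Set.Finite.mem_toFinset,
        Set.mem_ofPred_eq]
      exact ⟨i, ⟨h2, h1⟩, hx, h3⟩
    have hcard := (Finset.card_le_card hsub).trans Finset.card_biUnion_le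
    have hpos : (0 : ℝ) < (W n).card := by exact_mod_cast (hW n).card_pos
    have hterm : ∀ i ∈ I, (((W n).filter fun x => x ∈ bad i n).card : ℝ) ≤
        (W n).card * (1 / 2) ^ (g i + 1) := by
      intro i hi
      simp only [I, Finset.mem_filter] at hi
      have h := hN i n hi.2
      have h' : ((W n : Set α) ∩ bad i n).ncard = ((W n).filter fun x => x ∈ bad i n).card := by
        rw [← Set.ncard_coe_finset]
        congr 1
        ext x
        simp
      rw [h'] at h
      have h2 : (((W n).filter fun x => x ∈ bad i n).card : ℝ) * 2 ^ (g i + 1) < (W n).card := by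
        exact_mod_cast h
      rw [one_div, inv_pow, ← div_eq_mul_inv, le_div_iff₀ (by positivity)]
      exact h2.le
    have hsum : ∑ i ∈ I, (1 / 2 : ℝ) ^ (g i + 1) < 1 := by
      have h1 : ∑ i ∈ I, (1 / 2 : ℝ) ^ (g i + 1) = ∑ j ∈ I.image g, (1 / 2 : ℝ) ^ (j + 1) :=
        (Finset.sum_image (f := fun j : ℕ => (1 / 2 : ℝ) ^ (j + 1)) hg.injOn).symm
      have h2 : I.image g ⊆ Finset.range n := by
        intro j hj
        obtain ⟨i, hi, rfl⟩ := Finset.mem_image.1 hj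
        simp only [I, Finset.mem_filter, Set.Finite.mem_toFinset, Set.mem_ofPred_eq] at hi
        exact Finset.mem_range.2 hi.1
      have h3 : ∑ j ∈ Finset.range n, (1 / 2 : ℝ) ^ (j + 1) = 1 - (1 / 2) ^ n := by
        clear * -
        induction n with
        | zero => simp
        | succ n ih => rw [Finset.sum_range_succ, ih]; ring
      have h4 : (0 : ℝ) < (1 / 2) ^ n := by positivity
      have h5 := Finset.sum_le_sum_of_subset_of_nonneg (f := fun j => (1 / 2 : ℝ) ^ (j + 1)) h2
        fun _ _ _ => by positivity
      rw [h1]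
      linarith
    have : ((W n).card : ℝ) ≤ (W n).card * ∑ i ∈ I, (1 / 2 : ℝ) ^ (g i + 1) := by
      calc ((W n).card : ℝ) ≤ ∑ i ∈ I, (((W n).filter fun x => x ∈ bad i n).card : ℝ) := by
            exact_mod_cast hcard
        _ ≤ ∑ i ∈ I, (W n).card * (1 / 2 : ℝ) ^ (g i + 1) := Finset.sum_le_sum hterm
        _ = _ := by rw [Finset.mul_sum]
    nlinarith
  choose w hw hwb using key
  refine ⟨w, hw, fun i => ?_⟩
  filter_upwards [Filter.eventually_ge_atTop (N i), Filter.eventually_gt_atTop (g i)] with n h1 h2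
  exact hwb n i h1 h2

/-! ### Partial computations of online machines -/

namespace OnlineTM

/-- The memory of a machine: a configuration without the remaining input and the output. -/
structure Core (k g : ℕ) where
  state : Fin k
  lenPos : ℕ
  tape : ℕ → Fin g
  head : ℕ

namespace Core

variable {A : Type u} {k g : ℕ}

/-- The configuration with given memory, remaining input and output. -/
def cfg (c : Core k g) (w o : List A) : Cfg A k g := ⟨c.state, w, c.lenPos, c.tape, c.head, o⟩

/-- The memory after an action, on inputs of length `n`. -/
def apply (c : Core k g) (n : ℕ) (act : Action A k g) : Core k g :=
  ⟨act.next, min (act.lenMove.apply c.lenPos) n.bits.length,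
    Function.update c.tape c.head act.write, act.workMove.apply c.head⟩

end Core

/-- The memory of a configuration. -/
def Cfg.core {A : Type u} {k g : ℕ} (x : Cfg A k g) : Core k g := ⟨x.state, x.lenPos, x.tape, x.head⟩

variable {A : Type u} (M : OnlineTM A)

/-- The action that `M` takes with memory `c` and remaining input `w`, on inputs of length `n`. -/
def action (n : ℕ) (c : Core M.numStates M.numSymbols) (w : List A) :
    Option (Action A M.numStates M.numSymbols) :=
  M.δ c.state w.head? (n.bits[c.lenPos]?) (c.tape c.head)

/-- The initial memory. -/
def initCore : Core M.numStates M.numSymbols := ⟨M.start, 0, fun _ => M.blank, 0⟩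

lemma init_eq (w : List A) : M.init w = M.initCore.cfg w [] := rfl

lemma step_eq_some {n : ℕ} {x y : Cfg A M.numStates M.numSymbols} :
    M.step n x = some y ↔ ∃ act, M.action n x.core x.input = some act ∧
      y = (x.core.apply n act).cfg (if act.advance then x.input.tail else x.input)
        (x.output ++ act.emit.toList) := by
  simp only [step, Option.map_eq_some_iff, action, Cfg.core, Core.apply, Core.cfg]
  exact ⟨fun ⟨act, h1, h2⟩ => ⟨act, h1, h2.symm⟩, fun ⟨act, h1, h2⟩ => ⟨act, h1, h2.symm⟩⟩

/-- `M` gets from memory `c` to memory `c'` by reading exactly the word `x`, while it writes `o`. -/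
inductive Consumes (n : ℕ) : Core M.numStates M.numSymbols → List A →
    Core M.numStates M.numSymbols → List A → Prop
  | nil (c) : Consumes n c [] c []
  | stay {c a x act c' o} : M.action n c (a :: x) = some act → act.advance = false →
      Consumes n (c.apply n act) (a :: x) c' o → Consumes n c (a :: x) c' (act.emit.toList ++ o)
  | advance {c a x act c' o} : M.action n c (a :: x) = some act → act.advance = true →
      Consumes n (c.apply n act) x c' o → Consumes n c (a :: x) c' (act.emit.toList ++ o)

variable {M}

lemma Consumes.append {n : ℕ} {c c' c'' : Core M.numStates M.numSymbols} {x y o o' : List A}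
    (h : M.Consumes n c x c' o) (h' : M.Consumes n c' y c'' o') :
    M.Consumes n c (x ++ y) c'' (o ++ o') := by
  induction h with
  | nil => exact h'
  | stay h1 h2 _ ih => rw [List.append_assoc]; exact .stay h1 h2 (ih h')
  | advance h1 h2 _ ih => rw [List.append_assoc]; exact .advance h1 h2 (ih h')

lemma Consumes.reaches {n : ℕ} {c c' : Core M.numStates M.numSymbols} {x o : List A}
    (h : M.Consumes n c x c' o) (v out : List A) :
    StateTransition.Reaches (M.step n) (c.cfg (x ++ v) out) (c'.cfg v (out ++ o)) := by
  induction h generalizing out with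
  | nil => rw [List.append_nil]; exact Relation.ReflTransGen.refl
  | stay h1 h2 _ ih =>
    refine Relation.ReflTransGen.head ((M.step_eq_some).2 ⟨_, h1, rfl⟩) ?_
    rw [← List.append_assoc]
    simpa [h2, Core.cfg, Cfg.core, StateTransition.Reaches] using ih (out ++ _)
  | advance h1 h2 _ ih =>
    refine Relation.ReflTransGen.head ((M.step_eq_some).2 ⟨_, h1, rfl⟩) ?_
    rw [← List.append_assoc]
    simpa [h2, Core.cfg, Cfg.core, StateTransition.Reaches] using ih (out ++ _)

/-- Cuts a computation at the moment when the input head leaves x. The length condition says that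
the head does get that far. -/
lemma exists_consumes {n : ℕ} {X Y : Cfg A M.numStates M.numSymbols}
    (h : StateTransition.Reaches (M.step n) X Y) :
    ∀ x v, X.input = x ++ v → Y.input.length ≤ v.length → ∃ c' o, M.Consumes n X.core x c' o ∧
      StateTransition.Reaches (M.step n) (c'.cfg v (X.output ++ o)) Y := by
  induction h using Relation.ReflTransGen.head_induction_on with
  | refl =>
    intro x v h1 h2
    have : x = [] := by
      rw [← List.length_eq_zero_iff]
      rw [h1, List.length_append] at h2
      omega
    subst this
    refine ⟨_, [], .nil _, ?_⟩
    rw [List.append_nil, show v = Y.input from h1.symm]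
    exact Relation.ReflTransGen.refl
  | @head X Z h1 h2 ih =>
    rintro (_ | ⟨a, x⟩) v h3 h4
    · refine ⟨_, [], .nil _, ?_⟩
      rw [List.append_nil, show v = X.input from h3.symm]
      exact Relation.ReflTransGen.head h1 h2
    · obtain ⟨act, h5, rfl⟩ := M.step_eq_some.1 h1
      have h6 : M.action n X.core (a :: x) = some act := by
        rw [h3] at h5
        exact h5
      by_cases hadv : act.advance = true
      · obtain ⟨c', o, h7, h8⟩ := ih x v (by simp [Core.cfg, hadv, h3]) h4
        refine ⟨c', _, .advance h6 hadv h7, ?_⟩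
        rw [← List.append_assoc]
        exact h8
      · obtain ⟨c', o, h7, h8⟩ := ih (a :: x) v (by simp [Core.cfg, hadv, h3]) h4
        refine ⟨c', _, .stay h6 (by simpa using hadv) h7, ?_⟩
        rw [← List.append_assoc]
        exact h8

lemma output_prefix {n : ℕ} {X Y : Cfg A M.numStates M.numSymbols}
    (h : StateTransition.Reaches (M.step n) X Y) : X.output <+: Y.output := by
  induction h using Relation.ReflTransGen.head_induction_on with
  | refl => exact List.prefix_rfl
  | head h1 _ ih =>
    obtain ⟨act, _, rfl⟩ := M.step_eq_some.1 h1
    exact (List.prefix_append _ _).trans ih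

/-- What lies beyond the input head does not matter. -/
lemma reaches_change_suffix {n : ℕ} {X Y : Cfg A M.numStates M.numSymbols}
    (h : StateTransition.Reaches (M.step n) X Y) {y s : List A} (hy : y ≠ []) (hY : Y.input = y ++ s) :
    ∃ x, x ≠ [] ∧ X.input = x ++ s ∧ ∀ s', StateTransition.Reaches (M.step n)
      (X.core.cfg (x ++ s') X.output) (Y.core.cfg (y ++ s') Y.output) := by
  induction h using Relation.ReflTransGen.head_induction_on with
  | refl => exact ⟨y, hy, hY, fun s' => Relation.ReflTransGen.refl⟩
  | @head X Z h1 _ ih =>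
    obtain ⟨x, hx, h2, h3⟩ := ih
    obtain ⟨act, h5, rfl⟩ := M.step_eq_some.1 h1
    obtain ⟨a, x, rfl⟩ := List.exists_cons_of_ne_nil hx
    by_cases hadv : act.advance = true
    · simp only [Core.cfg, hadv, if_true] at h2
      obtain ⟨b, z, hz⟩ : ∃ b z, X.input = b :: z := List.exists_cons_of_ne_nil (by
        rintro h
        simp [h] at h2)
      rw [hz, List.tail_cons] at h2
      refine ⟨b :: a :: x, by simp, by rw [hz, h2]; rfl, fun s' => ?_⟩
      refine Relation.ReflTransGen.head (M.step_eq_some.2 ⟨act, ?_, rfl⟩) ?_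
      · rw [hz] at h5
        exact h5
      · simpa [hadv, Core.cfg, Cfg.core, StateTransition.Reaches] using h3 s'
    · simp only [Core.cfg, hadv] at h2
      refine ⟨a :: x, by simp, by simpa using h2, fun s' => ?_⟩
      refine Relation.ReflTransGen.head (M.step_eq_some.2 ⟨act, ?_, rfl⟩) ?_
      · simp only [Bool.false_eq_true, if_false] at h2
        rw [h2] at h5
        exact h5
      · simpa [hadv, Core.cfg, Cfg.core, StateTransition.Reaches] using h3 s'

lemma Computes.eq_of_reaches {f : List A → List A} (hf : M.Computes f) {w : List A}
    {X Y : Cfg A M.numStates M.numSymbols}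
    (h : StateTransition.Reaches (M.step w.length) (M.init w) X)
    (h' : StateTransition.Reaches (M.step w.length) X Y) (hY : M.step w.length Y = none) :
    Y.output = f w := by
  obtain ⟨Z, h1, h2, h3⟩ := hf w
  have e1 := StateTransition.mem_eval.2 ⟨h1, h2⟩
  have e2 := StateTransition.mem_eval.2 ⟨h.trans h', hY⟩
  rw [← h3, Part.mem_unique e1 e2]

/-- If `M` computes an injective map, then two words that lead `M` from the same memory to the same
memory with the same output are equal. -/
lemma Computes.eq_of_consumes {f : List A → List A} (hf : M.Computes f)
    (hinj : Function.Injective f) {n : ℕ} {u x x' o₀ o : List A}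
    {c₀ c : Core M.numStates M.numSymbols} (hx : x.length = x'.length)
    (hn : u.length + x.length ≤ n) (h₀ : M.Consumes n M.initCore u c₀ o₀)
    (h : M.Consumes n c₀ x c o) (h' : M.Consumes n c₀ x' c o) : x = x' := by
  rcases x with _ | ⟨a, y⟩
  · exact (List.length_eq_zero_iff.1 hx.symm).symm
  set x := a :: y
  -- The length tape shows n, so both inputs are padded to length exactly n, with the same suffix.
  set v := List.replicate (n - (u.length + x.length)) a
  have hl : (u ++ (x ++ v)).length = n := by simp [v]; omega
  have hl' : (u ++ (x' ++ v)).length = n := by simp [v]; omega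
  have r := (h₀.reaches (x ++ v) []).trans (h.reaches v _)
  have r' := (h₀.reaches (x' ++ v) []).trans (h'.reaches v _)
  obtain ⟨Z, h1, h2, h3⟩ := hf (u ++ (x ++ v))
  rw [hl] at h1 h2
  -- By determinism the two configurations are comparable, and Z has no successor.
  have hr : StateTransition.Reaches (M.step n) (c.cfg v ([] ++ o₀ ++ o)) Z := by
    rcases StateTransition.reaches_total h1 r with h | h
    · rcases Relation.ReflTransGen.cases_head h with h | ⟨W, h, _⟩
      · exact h ▸ Relation.ReflTransGen.refl
      · rw [h2] at h
        cases h
    · exact h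
  have e := hf.eq_of_reaches (w := u ++ (x' ++ v)) (by rw [hl', init_eq]; exact r')
    (by rw [hl']; exact hr) (by rw [hl']; exact h2)
  have := hinj (h3.symm.trans e)
  rw [List.append_cancel_left_eq, List.append_cancel_right_eq] at this
  exact this

/-- If `M` computes an injective map, then it reads its input up to the last letter at least. -/
lemma Computes.length_input_le_one [Nontrivial A] {f : List A → List A} (hf : M.Computes f)
    (hinj : Function.Injective f) {w : List A} {Y : Cfg A M.numStates M.numSymbols}
    (h : StateTransition.Reaches (M.step w.length) (M.init w) Y)
    (hY : M.step w.length Y = none) : Y.input.length ≤ 1 := by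
  by_contra! hlt
  obtain ⟨a, b, r, hr⟩ : ∃ a b r, Y.input = a :: b :: r := by
    match hYi : Y.input with
    | [] => simp [hYi] at hlt
    | [_] => simp [hYi] at hlt
    | a :: b :: r => exact ⟨a, b, r, rfl⟩
  -- If the machine halted while scanning a, it would never have seen the next letter b; replacing b
  -- by b' would leave the output unchanged.
  obtain ⟨b', hb⟩ := exists_ne b
  obtain ⟨x, hx, h1, h2⟩ := reaches_change_suffix h (y := [a]) (s := b :: r) (by simp) hr
  have h3 := h2 (b' :: r)
  change w = _ at h1
  have hl : (x ++ b' :: r).length = w.length := by simp [h1]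
  have hY' : M.step w.length (Y.core.cfg ([a] ++ b' :: r) Y.output) = none := by
    rw [Option.eq_none_iff_forall_ne_some] at hY ⊢
    intro Z hZ
    obtain ⟨act, h5, _⟩ := M.step_eq_some.1 hZ
    refine hY _ (M.step_eq_some.2 ⟨act, ?_, rfl⟩)
    rw [hr]
    exact h5
  have e1 := hf.eq_of_reaches h Relation.ReflTransGen.refl hY
  have e2 := hf.eq_of_reaches (w := x ++ b' :: r) (by rw [hl]; exact h3)
    Relation.ReflTransGen.refl (by rw [hl]; exact hY')
  have e3 := hinj (e1.symm.trans e2)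
  rw [h1, List.append_cancel_left_eq] at e3
  simp only [List.cons.injEq, and_true] at e3
  exact hb e3.symm

/-- A lower bound on the output of a computation, from lower bounds on what is written while the
single blocks of the input are read. -/
lemma sum_le_length_output {n : ℕ} {v : List A} {Y : Cfg A M.numStates M.numSymbols}
    (g : List A → ℝ) (hY : Y.input.length ≤ v.length) : ∀ (bs : List (List A)) (u o₀ : List A)
    (c₀ : Core M.numStates M.numSymbols), M.Consumes n M.initCore u c₀ o₀ →
    u.length + bs.flatten.length ≤ n →
    StateTransition.Reaches (M.step n) (c₀.cfg (bs.flatten ++ v) o₀) Y →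
    (∀ b ∈ bs, ∀ u c₀ o₀ c o, u.length + b.length ≤ n → M.Consumes n M.initCore u c₀ o₀ →
      M.Consumes n c₀ b c o → g b ≤ o.length) →
    o₀.length + (bs.map g).sum ≤ (Y.output.length : ℝ)
  | [], u, o₀, c₀, _, _, h, _ => by
    simpa [Core.cfg] using (output_prefix h).length_le
  | b :: bs, u, o₀, c₀, h₀, hn, h, hg => by
    rw [List.flatten_cons, List.length_append] at hn
    obtain ⟨c, o, h1, h2⟩ := exists_consumes h b (bs.flatten ++ v)
      (by simp [Core.cfg]) (by rw [List.length_append]; omega)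
    have h3 := sum_le_length_output g hY bs (u ++ b) (o₀ ++ o) c (h₀.append h1)
      (by rw [List.length_append]; omega) h2 fun b' hb' => hg b' (List.mem_cons_of_mem _ hb')
    have h4 := hg b List.mem_cons_self u c₀ o₀ c o (by omega) h₀ h1
    rw [List.length_append, Nat.cast_add] at h3
    rw [List.map_cons, List.sum_cons]
    linarith

/-! ### Counting memories -/

/-- The memory fits into `N` work tape cells and `N` positions on the length tape. -/
structure Core.Fits (N : ℕ) (c : Core M.numStates M.numSymbols) : Prop where
  lenPos_lt : c.lenPos < N
  head_lt : c.head < N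
  tape_eq : ∀ i, N ≤ i → c.tape i = M.blank

/-- The content of a memory that fits into `N` cells. -/
def Core.key (N : ℕ) [NeZero N] (c : Core M.numStates M.numSymbols) :
    Fin M.numStates × Fin N × (Fin N → Fin M.numSymbols) × Fin N :=
  (c.state, Fin.ofNat N c.lenPos, fun i => c.tape i, Fin.ofNat N c.head)

lemma Core.Fits.key_injective {N : ℕ} [NeZero N] {c c' : Core M.numStates M.numSymbols}
    (h : c.Fits N) (h' : c'.Fits N) (hk : c.key N = c'.key N) : c = c' := by
  obtain ⟨s, l, t, p⟩ := c
  obtain ⟨s', l', t', p'⟩ := c'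
  simp only [key, Prod.mk.injEq, Fin.ext_iff, Fin.val_ofNat, funext_iff] at hk
  obtain ⟨h1, h2, h3, h4⟩ := hk
  have e1 := h.lenPos_lt
  have e2 := h.head_lt
  have e3 := h'.lenPos_lt
  have e4 := h'.head_lt
  simp only at e1 e2 e3 e4
  rw [Nat.mod_eq_of_lt e1, Nat.mod_eq_of_lt e3] at h2
  rw [Nat.mod_eq_of_lt e2, Nat.mod_eq_of_lt e4] at h4
  have ht : t = t' := by
    funext i
    rcases lt_or_ge i N with hi | hi
    · exact Fin.ext (h3 ⟨i, hi⟩)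
    · exact (h.tape_eq i hi).trans (h'.tape_eq i hi).symm
  rw [Core.mk.injEq]
  exact ⟨Fin.ext h1, h2, ht, h4⟩

lemma fits_of_reaches {N : ℕ} {w : List A} (hb : w.length.bits.length < N)
    (hN : ∀ x, StateTransition.Reaches (M.step w.length) (M.init w) x → x.head < N)
    {Y : Cfg A M.numStates M.numSymbols}
    (h : StateTransition.Reaches (M.step w.length) (M.init w) Y) : Y.core.Fits N := by
  induction h with
  | refl => exact ⟨by simp [init_eq, Core.cfg, initCore, Cfg.core]; omega,
      hN _ Relation.ReflTransGen.refl, fun _ _ => rfl⟩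
  | @tail X Z h1 h2 ih =>
    refine ⟨?_, hN _ (h1.tail h2), fun i hi => ?_⟩
    all_goals obtain ⟨act, _, rfl⟩ := M.step_eq_some.1 h2
    · exact (min_le_right _ _).trans_lt hb
    · change Function.update X.tape X.head act.write i = _
      have := ih.head_lt
      rw [Function.update_of_ne]
      · exact ih.tape_eq i hi
      · rintro rfl
        exact absurd this (not_lt.2 hi)

variable (M)

/-- Words of length `j` for which `M` writes at most `T` letters, when they stand somewhere in an
input of length at most `j ^ 4`. -/
def terse (j T : ℕ) : Set (List A) :=
  {x | x.length = j ∧ ∃ n u c₀ o₀ c o, n ≤ j ^ 4 ∧ u.length + j ≤ n ∧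
    M.Consumes n M.initCore u c₀ o₀ ∧ M.Consumes n c₀ x c o ∧ o.length ≤ T}

variable {M}

/-- A terse word is recovered from the input length, the two memories and the output. The factors
count these data: the lengths up to j⁴, two memories on N cells, and an output given by its length
and its padding to T letters. -/
lemma ncard_terse_le [Fintype A] [Nonempty A] {f : List A → List A} (hf : M.Computes f)
    (hinj : Function.Injective f) {j T N : ℕ}
    (hN : ∀ w : List A, w.length ≤ j ^ 4 → w.length.bits.length < N ∧
      ∀ x, StateTransition.Reaches (M.step w.length) (M.init w) x → x.head < N) :
    (M.terse j T).ncard ≤ (j ^ 4 + 1) * (M.numStates * (N * (M.numSymbols ^ N * N))) ^ 2 *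
      ((T + 1) * Fintype.card A ^ T) := by
  classical
  have a₀ : A := Classical.arbitrary A
  have hN0 : 0 < N := (Nat.zero_le _).trans_lt (hN [] (Nat.zero_le _)).1
  have : NeZero N := ⟨hN0.ne'⟩
  have : Nonempty (Core M.numStates M.numSymbols) := ⟨M.initCore⟩
  choose! n u c₀ o₀ c o hn hu h₀ h ho using fun x (hx : x ∈ M.terse j T) => hx.2
  have hlen : ∀ x ∈ M.terse j T, x.length = j := fun x hx => hx.1
  have hfit : ∀ x ∈ M.terse j T, (c₀ x).Fits N ∧ (c x).Fits N := by
    intro x hx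
    set w := u x ++ (x ++ List.replicate (n x - ((u x).length + j)) a₀)
    have hw : w.length = n x := by
      have := hu x hx
      simp only [w, List.length_append, List.length_replicate, hlen x hx]
      omega
    obtain ⟨h3, h4⟩ := hN w (hw ▸ hn x hx)
    have h1 := (h₀ x hx).reaches (x ++ List.replicate (n x - ((u x).length + j)) a₀) []
    have h2 := h1.trans ((h x hx).reaches _ _)
    have hi : M.initCore.cfg (u x ++ (x ++ List.replicate (n x - ((u x).length + j)) a₀)) [] =
      M.init w := rfl
    rw [hi, ← hw] at h1 h2
    exact ⟨fits_of_reaches h3 h4 h1, fits_of_reaches h3 h4 h2⟩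
  let K := Fin M.numStates × Fin N × (Fin N → Fin M.numSymbols) × Fin N
  let F : List A → (Fin (j ^ 4 + 1) × K × K) × (Fin (T + 1) × (Fin T → A)) := fun x =>
    ((Fin.ofNat _ (n x), (c₀ x).key N, (c x).key N), (Fin.ofNat _ (o x).length,
      fun i => (o x).getD i a₀))
  have hF : Set.InjOn F (M.terse j T) := by
    intro x hx y hy hxy
    simp only [F, Prod.mk.injEq, Fin.ext_iff, Fin.val_ofNat] at hxy
    obtain ⟨⟨e1, e2, e3⟩, e4, e5⟩ := hxy
    rw [Nat.mod_eq_of_lt (Nat.lt_succ_of_le (hn x hx)),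
      Nat.mod_eq_of_lt (Nat.lt_succ_of_le (hn y hy))] at e1
    rw [Nat.mod_eq_of_lt (Nat.lt_succ_of_le (ho x hx)),
      Nat.mod_eq_of_lt (Nat.lt_succ_of_le (ho y hy))] at e4
    have e2' := (hfit x hx).1.key_injective (hfit y hy).1 e2
    have e3' := (hfit x hx).2.key_injective (hfit y hy).2 e3
    have e5' : o x = o y := by
      refine List.ext_getElem e4 fun i hi hi' => ?_
      have := congrFun e5 ⟨i, hi.trans_le (ho x hx)⟩
      simpa [List.getD_eq_getElem, hi, hi'] using this
    refine hf.eq_of_consumes hinj (by rw [hlen x hx, hlen y hy]) (by rw [hlen x hx]; exact hu x hx)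
      (h₀ x hx) (h x hx) ?_
    rw [e1, e2', e3', e5']
    exact h y hy
  have := Set.ncard_le_ncard_of_injOn F (fun x _ => Set.mem_univ _) hF Set.finite_univ
  refine this.trans (le_of_eq ?_)
  rw [Set.ncard_univ, Nat.card_eq_fintype_card]
  simp only [K, Fintype.card_prod, Fintype.card_fin, Fintype.card_pi, Finset.prod_const,
    Finset.card_univ]
  ring

end OnlineTM

/-! ### Predictive coding -/

/-- A deterministic machine that predicts the next letter, together with code words for a run of
correct predictions and for a wrong one. -/
structure Predictor (X : Type*) (A : Type u) (v : ℕ) where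
  next : X → A → X
  pred : X → Option A
  tick : List A
  code : Fin (v + 1) → A → List A

namespace Predictor

variable {X : Type*} {A : Type u} {v : ℕ} (P : Predictor X A v)

/-- No code word is a prefix of another one. -/
structure IsPrefixFree : Prop where
  tick_ne_nil : P.tick ≠ []
  code_ne_nil : ∀ t b, P.code t b ≠ []
  tick_ne_code : ∀ t b r s, P.tick ++ r ≠ P.code t b ++ s
  code_inj : ∀ t b r t' b' s, P.code t b ++ r = P.code t' b' ++ s → t = t' ∧ b = b'

/-- All letters are predicted correctly. -/
def Hits : X → List A → Prop
  | _, [] => True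
  | x, b :: w => P.pred x = some b ∧ Hits (P.next x b) w

/-- No letter is predicted correctly. -/
def Misses : X → List A → Prop
  | _, [] => True
  | x, b :: w => P.pred x ≠ some b ∧ Misses (P.next x b) w

variable {P} in
lemma hits_append {x : X} {w w' : List A} :
    P.Hits x (w ++ w') ↔ P.Hits x w ∧ P.Hits (w.foldl P.next x) w' := by
  induction w generalizing x with
  | nil => simp [Hits]
  | cons b w ih => simp [Hits, ih, and_assoc]

variable [DecidableEq A]

/-- The output for one letter, when `t` predictions have been correct since the last output. -/
def emit (x : X) (t : Fin (v + 1)) (b : A) : List A :=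
  if P.pred x = some b then if t = Fin.last v then P.tick else [] else P.code t b

/-- The new number of correct predictions since the last output. -/
def count (x : X) (t : Fin (v + 1)) (b : A) : Fin (v + 1) :=
  if P.pred x = some b then t + 1 else 0

/-- Output and final count of correct predictions. -/
def encode : X → Fin (v + 1) → List A → List A × Fin (v + 1)
  | _, t, [] => ([], t)
  | x, t, b :: w =>
    (P.emit x t b ++ (encode (P.next x b) (P.count x t b) w).1,
      (encode (P.next x b) (P.count x t b) w).2)

variable {P}

lemma encode_append (x : X) (t : Fin (v + 1)) (w w' : List A) :
    P.encode x t (w ++ w') =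
      ((P.encode x t w).1 ++ (P.encode (w.foldl P.next x) (P.encode x t w).2 w').1,
        (P.encode (w.foldl P.next x) (P.encode x t w).2 w').2) := by
  induction w generalizing x t with
  | nil => rfl
  | cons b w ih => simp [encode, ih]

lemma val_add_one_of_ne {t : Fin (v + 1)} (h : t ≠ Fin.last v) : ((t + 1 : Fin (v + 1)) : ℕ) = t + 1 :=
  Fin.val_add_one_of_lt (lt_of_le_of_ne (Fin.le_last t) h)

/-- Each tick of two letters pays for v + 1 hits, of which up to t were made earlier. -/
lemma length_encode_of_hits (htick : P.tick.length = 2) :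
    ∀ (w : List A) (x : X) (t : Fin (v + 1)), P.Hits x w →
      (v + 1) * (P.encode x t w).1.length ≤ 2 * (t + w.length)
  | [], x, t, _ => by simp [encode]
  | b :: w, x, t, h => by
    have ih := length_encode_of_hits htick w (P.next x b) (t + 1) h.2
    by_cases ht : t = Fin.last v
    · subst ht
      simp only [Fin.last_add_one, Fin.val_zero] at ih
      simp only [encode, emit, count, h.1, if_true, List.length_append, htick, Fin.last_add_one,
        Fin.val_last, List.length_cons]
      linarith
    · rw [val_add_one_of_ne ht] at ih
      simp only [encode, emit, count, h.1, if_true, if_neg ht, List.length_append,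
        List.length_cons, List.length_nil]
      linarith

/-- Only the first miss can be expensive, as it reports the pending hits. After it the count stays
0. -/
lemma length_encode_of_misses {N : ℕ} (hN : ∀ t b, (P.code t b).length ≤ N + 1) (w : List A) (x : X)
    (t : Fin (v + 1)) (hw : ∀ b ∈ w, (P.code 0 b).length = 1) (h : P.Misses x w) :
    (P.encode x t w).1.length ≤ w.length + N := by
  have key : ∀ (w : List A) (x : X), (∀ b ∈ w, (P.code 0 b).length = 1) → P.Misses x w →
      (P.encode x 0 w).1.length = w.length := by
    intro w
    induction w with
    | nil => intros; rfl
    | cons b w ih =>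
      intro x hw h
      have := ih (P.next x b) (fun c hc => hw c (List.mem_cons_of_mem _ hc)) h.2
      simp only [encode, emit, count, if_neg h.1, List.length_append, List.length_cons, this,
        hw b List.mem_cons_self]
      omega
  cases w with
  | nil => simp [encode]
  | cons b w =>
    have := key w (P.next x b) (fun c hc => hw c (List.mem_cons_of_mem _ hc)) h.2
    have := hN t b
    simp only [encode, emit, count, if_neg h.1, List.length_append, List.length_cons]
    omega

/-! ### Unique decodability of predictive coding -/

section Injective

variable (hP : P.IsPrefixFree)
include hP

lemma encode_eq_nil : ∀ (w : List A) (x : X) (t : Fin (v + 1)), (P.encode x t w).1 = [] →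
    ((P.encode x t w).2 : ℕ) = t + w.length
  | [], x, t, _ => rfl
  | b :: w, x, t, h => by
    by_cases hb : P.pred x = some b
    · by_cases ht : t = Fin.last v
      · simp [encode, emit, hb, ht, hP.tick_ne_nil] at h
      · simp only [encode, emit, count, hb, if_true, if_neg ht, List.nil_append] at h ⊢
        rw [encode_eq_nil w _ _ h, val_add_one_of_ne ht, List.length_cons]
        omega
    · simp [encode, emit, hb, hP.code_ne_nil] at h

/-- Before the first output the count can only grow, so the count reported by a first code word is
at least the initial one. -/
lemma le_of_encode_eq_code : ∀ (w : List A) (x : X) (t t' : Fin (v + 1)) (b : A) (r : List A),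
    (P.encode x t' w).1 = P.code t b ++ r → (t' : ℕ) ≤ t
  | [], x, t, t', b, r, h => by
    have := hP.code_ne_nil t b
    simp [encode] at h
    tauto
  | c :: w, x, t, t', b, r, h => by
    by_cases hc : P.pred x = some c
    · by_cases ht : t' = Fin.last v
      · simp only [encode, emit, hc, ht, if_true] at h
        exact absurd h (hP.tick_ne_code _ _ _ _)
      · simp only [encode, emit, count, hc, if_true, if_neg ht, List.nil_append] at h
        have := le_of_encode_eq_code w _ _ _ _ _ h
        rw [val_add_one_of_ne ht] at this
        omega
    · simp only [encode, emit, if_neg hc] at h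
      rw [(hP.code_inj _ _ _ _ _ _ h).1]

/-- A miss writes the code word for count t now. A hit either writes a tick or raises the count
silently to t + 1, after which the first code word cannot report t. -/
lemma encode_ne_of_hit_of_miss {x : X} {t : Fin (v + 1)} {b c : A} {w w' : List A}
    (hb : P.pred x = some b) (hc : P.pred x ≠ some c) :
    (P.encode x t (b :: w)).1 ≠ (P.encode x t (c :: w')).1 := by
  intro h
  by_cases ht : t = Fin.last v
  · simp only [encode, emit, hb, if_true, if_pos ht] at h
    rw [if_neg (fun h => hc (hb.trans h))] at h
    exact hP.tick_ne_code _ _ _ _ h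
  · simp only [encode, emit, if_neg hc] at h
    simp only [count, hb, if_true, if_neg ht, List.nil_append] at h
    have := le_of_encode_eq_code hP _ _ _ _ _ _ h
    rw [val_add_one_of_ne ht] at this
    omega

/-- A predictive coder with a prefix code is one-to-one. -/
lemma encode_injective : ∀ (w w' : List A) (x : X) (t : Fin (v + 1)),
    P.encode x t w = P.encode x t w' → w = w'
  | [], [], _, _, _ => rfl
  | [], c :: w', x, t, h => by
    have := encode_eq_nil hP (c :: w') x t (by rw [← h]; rfl)
    rw [← h] at this
    simp [encode] at this
  | b :: w, [], x, t, h => by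
    have := encode_eq_nil hP (b :: w) x t (by rw [h]; rfl)
    rw [h] at this
    simp [encode] at this
  | b :: w, c :: w', x, t, h => by
    have hbc : b = c := by
      by_cases hb : P.pred x = some b
      · by_cases hc : P.pred x = some c
        · exact Option.some.inj (hb.symm.trans hc)
        · exact absurd (congrArg Prod.fst h) (encode_ne_of_hit_of_miss hP hb hc)
      · by_cases hc : P.pred x = some c
        · exact absurd (congrArg Prod.fst h).symm (encode_ne_of_hit_of_miss hP hc hb)
        · have := congrArg Prod.fst h
          simp only [encode, emit, if_neg hb, if_neg hc] at this
          exact (hP.code_inj _ _ _ _ _ _ this).2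
    subst hbc
    simp only [encode, Prod.mk.injEq, List.append_cancel_left_eq] at h
    rw [encode_injective w w' _ _ (Prod.ext h.1 h.2)]

end Injective

end Predictor

/-! ### A visibly pushdown compressor for mirrored opening words -/

lemma replicate_append_cons_inj {A : Type*} {r c : A} (hrc : r ≠ c) {x y : List A} :
    ∀ {m n : ℕ}, List.replicate m r ++ c :: x = List.replicate n r ++ c :: y → m = n ∧ x = y
  | 0, 0, h => ⟨rfl, by simpa using h⟩
  | 0, n + 1, h => by simp [List.replicate_succ, hrc.symm] at h
  | m + 1, 0, h => by simp [List.replicate_succ, hrc] at h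
  | m + 1, n + 1, h => by
    simp only [List.replicate_succ, List.cons_append, List.cons.injEq, true_and] at h
    obtain ⟨h1, h2⟩ := replicate_append_cons_inj hrc h
    exact ⟨by rw [h1], h2⟩

namespace Brackets

variable {A : Type u} (B : Brackets A) {k : ℕ} (e : A ≃ Fin k)

/-- Stack symbols: calls, paired with the internal symbol before them, if any; `none` is the start
symbol. -/
abbrev StackSymbol (k : ℕ) := Option (Fin k × Option (Fin k))

/-- The internal symbol that has just been read, and the one that is expected. -/
abbrev Control (k : ℕ) := Option (Fin k) × Option (Fin k)

/-- New control state, and replacement of the top symbol of the stack. -/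
def move (p : Control k) (b : A) (g : StackSymbol k) : Control k × List (StackSymbol k) :=
  match B.kind b with
  | SymbolKind.call => ((none, none), [some (e b, p.1), g])
  | SymbolKind.ret =>
    match g with
    | none => ((none, none), [none])
    | some t => ((none, t.2), [])
  | SymbolKind.internal => ((if p.2 = some (e b) then none else some (e b), none), [g])

/-- The predicted letter. -/
def guess (p : Control k) (g : StackSymbol k) : Option A :=
  match p.2, g with
  | some h, _ => some (e.symm h)
  | none, some t => some (B.bar (e.symm t.1))
  | none, none => none

open Classical in
/-- The code word for the letter `b`, after `t` correct predictions. -/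
noncomputable def codeWord (c : A) (t : ℕ) (b : A) : List A :=
  if t = 0 ∧ B.kind b ≠ SymbolKind.ret then [b]
  else List.replicate (t + 2) (B.bar c) ++ c :: [b]

/-- The configurations of the compressor, as a predictor. -/
noncomputable def predictor (c : A) (v : ℕ) : Predictor (Control k × List (StackSymbol k)) A v where
  next x b := match x.2 with
    | [] => x
    | g :: s => ((B.move e x.1 b g).1, (B.move e x.1 b g).2 ++ s)
  pred x := match x.2 with
    | [] => none
    | g :: _ => B.guess e x.1 g
  tick := [B.bar c, c]
  code t b := B.codeWord c t b

variable {B} in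
lemma isPrefixFree_predictor {c : A} (hc : B.kind c = SymbolKind.call) (v : ℕ) :
    (B.predictor e c v).IsPrefixFree := by
  have hr := B.bar_call c hc
  have hne : B.bar c ≠ c := fun h => by rw [h, hc] at hr; cases hr
  -- A single letter is never a return, while all other code words start with the return `B.bar c`.
  -- The number of copies of it before c is 1 for the tick and t + 2 for a miss, so it tells these
  -- cases apart.
  constructor
  · simp [predictor]
  · intro t b
    simp only [predictor, codeWord]
    split_ifs <;> simp
  · intro t b r s h
    simp only [predictor, codeWord] at h
    split_ifs at h with h1
    · simp only [List.cons_append, List.nil_append, List.cons.injEq] at h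
      exact h1.2 (h.1 ▸ hr)
    · rw [List.append_assoc] at h
      have := (replicate_append_cons_inj (m := 1) hne h).1
      omega
  · intro t b r t' b' s h
    simp only [predictor, codeWord] at h
    split_ifs at h with h1 h2 h2
    · simp only [List.cons_append, List.nil_append, List.cons.injEq] at h
      exact ⟨Fin.ext (h1.1.trans h2.1.symm), h.1⟩
    · simp only [List.replicate_succ, List.cons_append, List.nil_append, List.cons.injEq] at h
      exact absurd (h.1 ▸ hr) h1.2
    · simp only [List.replicate_succ, List.cons_append, List.nil_append, List.cons.injEq] at h
      exact absurd (h.1 ▸ hr) h2.2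
    · rw [List.append_assoc, List.append_assoc] at h
      obtain ⟨h3, h4⟩ := replicate_append_cons_inj hne h
      exact ⟨Fin.ext (by omega), (List.cons.inj h4).1⟩

lemma length_codeWord_le (c : A) (t : ℕ) (b : A) : (B.codeWord c t b).length ≤ t + 4 := by
  rw [codeWord]
  split_ifs <;> simp

lemma length_codeWord_zero (c : A) {b : A} (hb : B.kind b ≠ SymbolKind.ret) :
    (B.codeWord c 0 b).length = 1 := by
  simp [codeWord, hb]

section Blocks

variable {B} {c : A} {v : ℕ}

/-- The stack below stays arbitrary for the induction. While w is read, the only possible prediction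
is a return, as the top is the start symbol or a call and no internal symbol is expected; hence
every letter misses. The mirror image then pops what w has pushed, and each letter of it is
predicted. -/
lemma foldl_next_opening {w : List A} (hw : B.Opening w) : ∀ (g : StackSymbol k)
    (s : List (StackSymbol k)), (∀ t, g = some t → B.kind (e.symm t.1) = SymbolKind.call) →
    ∃ x, w.foldl (B.predictor e c v).next ((none, none), g :: s) = x ∧
      (B.predictor e c v).Misses ((none, none), g :: s) w ∧
      (B.mirror w).foldl (B.predictor e c v).next x = ((none, none), g :: s) ∧
      (B.predictor e c v).Hits x (B.mirror w) := by
  have hret : ∀ (p : Option (Fin k)) (g : StackSymbol k) (s : List (StackSymbol k)) (b : A),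
      (∀ t, g = some t → B.kind (e.symm t.1) = SymbolKind.call) → B.kind b ≠ SymbolKind.ret →
      (B.predictor e c v).pred ((p, none), g :: s) ≠ some b := by
    intro p g s b hg hb h
    rcases g with _ | t
    · simp [predictor, guess] at h
    · simp only [predictor, guess, Option.some.injEq] at h
      exact hb (h ▸ B.bar_call _ (hg t rfl))
  induction hw with
  | nil => exact fun g s _ => ⟨_, rfl, trivial, rfl, trivial⟩
  | @call b w hb _ ih =>
    intro g s hg
    obtain ⟨x, h1, h2, h3, h4⟩ := ih (some (e b, none)) (g :: s) (by rintro _ ⟨⟩; simpa using hb)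
    have hn : (B.predictor e c v).next ((none, none), g :: s) b =
        ((none, none), some (e b, none) :: g :: s) := by simp [predictor, move, hb]
    have hn' : (B.predictor e c v).next ((none, none), some (e b, none) :: g :: s) (B.bar b) =
        ((none, none), g :: s) := by simp [predictor, move, B.bar_call b hb]
    refine ⟨x, by rw [List.foldl_cons, hn, h1], ⟨hret _ _ _ _ hg (by simp [hb]), hn ▸ h2⟩, ?_, ?_⟩
    · rw [mirror_cons, List.foldl_append, h3, List.foldl_cons, List.foldl_nil, hn']
    · rw [mirror_cons, Predictor.hits_append, h3]
      exact ⟨h4, by simp [predictor, guess], trivial⟩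
  | @internal h b w hh hb _ ih =>
    intro g s hg
    obtain ⟨x, h1, h2, h3, h4⟩ :=
      ih (some (e b, some (e h))) (g :: s) (by rintro _ ⟨⟩; simpa using hb)
    have hn₁ : (B.predictor e c v).next ((none, none), g :: s) h =
        ((some (e h), none), g :: s) := by simp [predictor, move, hh]
    have hn : (B.predictor e c v).next ((some (e h), none), g :: s) b =
        ((none, none), some (e b, some (e h)) :: g :: s) := by simp [predictor, move, hb]
    have hn' : (B.predictor e c v).next ((none, none), some (e b, some (e h)) :: g :: s)
        (B.bar b) = ((none, some (e h)), g :: s) := by simp [predictor, move, B.bar_call b hb]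
    have hn₁' : (B.predictor e c v).next ((none, some (e h)), g :: s) h =
        ((none, none), g :: s) := by simp [predictor, move, hh]
    refine ⟨x, by rw [List.foldl_cons, hn₁, List.foldl_cons, hn, h1],
      ⟨hret _ _ _ _ hg (by simp [hh]), ?_⟩, ?_, ?_⟩
    · rw [hn₁]
      exact ⟨hret _ _ _ _ hg (by simp [hb]), hn ▸ h2⟩
    · simp only [mirror_cons, List.foldl_append, h3, List.foldl_cons, List.foldl_nil, hn',
        B.bar_internal h hh, hn₁']
    · simp only [mirror_cons, Predictor.hits_append, List.foldl_append, h3, List.foldl_cons,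
        List.foldl_nil, hn', B.bar_internal h hh]
      exact ⟨⟨h4, by simp [predictor, guess], trivial⟩, by simp [predictor, guess], trivial⟩

lemma Opening.kind_ne_ret {w : List A} (hw : B.Opening w) : ∀ b ∈ w, B.kind b ≠ SymbolKind.ret := by
  induction hw with
  | nil => simp
  | call hb _ ih => simpa [hb] using ih
  | internal hh hb _ ih => simpa [hh, hb] using ih

end Blocks

variable [DecidableEq A]

/-- The compressor. -/
noncomputable def compressor (c : A) (v : ℕ) : BPDC A where
  Q := Control k × Fin (v + 1)
  Γ := StackSymbol k
  finiteQ := inferInstance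
  finiteΓ := inferInstance
  δ q b g := b.map fun b => (((B.move e q.1 b g).1,
    if B.guess e q.1 g = some b then q.2 + 1 else 0), (B.move e q.1 b g).2)
  ν q b g := if B.guess e q.1 g = some b then (if q.2 = Fin.last v then [B.bar c, c] else [])
    else B.codeWord c q.2 b
  q₀ := ((none, none), 0)
  z₀ := none
  c := 0
  bottom q b q' w h := by
    simp only [Option.map_eq_some_iff, Prod.mk.injEq] at h
    obtain ⟨b, _, _, rfl⟩ := h
    rw [move]
    cases B.kind b
    · exact ⟨[_], rfl⟩
    · exact ⟨[], rfl⟩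
    · exact ⟨[], rfl⟩
  lambda_pop q a q' w h := by simp at h
  deterministic q a := by simp

lemma compressor_obeysKinds (c : A) (v : ℕ) : (B.compressor e c v).ObeysKinds B.kind where
  no_lambda q a := rfl
  call b hb q a q' w h := by
    have h2 : (B.move e q.1 b a).2 = w := congrArg Prod.snd (Option.some.inj h)
    simp only [move, hb] at h2
    exact ⟨_, Option.some_ne_none _, h2.symm⟩
  ret_pop b hb q a q' w h ha := by
    obtain ⟨t, rfl⟩ := Option.ne_none_iff_exists'.1 ha
    have h2 : (B.move e q.1 b (some t)).2 = w := congrArg Prod.snd (Option.some.inj h)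
    simp only [move, hb] at h2
    exact h2.symm
  ret_empty b hb q q' w h := by
    have h2 : (B.move e q.1 b none).2 = w := congrArg Prod.snd (Option.some.inj h)
    simp only [move, hb] at h2
    exact h2.symm
  internal b hb q a q' w h := by
    have h2 : (B.move e q.1 b a).2 = w := congrArg Prod.snd (Option.some.inj h)
    simp only [move, hb] at h2
    exact h2.symm

/-- The start symbol stays at the bottom, so the stack is never empty and no transition is
undefined. The machine therefore follows the encoder step by step. -/
lemma foldlM_step_compressor (c : A) (v : ℕ) : ∀ (w : List A) (p : Control k) (t : Fin (v + 1))
    (s : List (StackSymbol k)) (o : List A), (∃ u, s = u ++ [none]) →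
    ∃ (p' : Control k) (s' : List (StackSymbol k)),
      w.foldlM (fun x b => (B.compressor e c v).step b x) (((p, t), s), o) =
        some ((((p', ((B.predictor e c v).encode (p, s) t w).2), s'),
          o ++ ((B.predictor e c v).encode (p, s) t w).1) :
            (((B.compressor e c v).Q × List (B.compressor e c v).Γ) × List A))
  | [], p, t, s, o, _ => ⟨p, s, by simp [Predictor.encode]⟩
  | b :: w, p, t, [], o, ⟨u, hu⟩ => by simp at hu
  | b :: w, p, t, g :: s, o, ⟨u, hu⟩ => by
    have hu' : ∃ u', (B.move e p b g).2 ++ s = u' ++ [none] := by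
      rcases u with _ | ⟨g', u⟩
      · simp only [List.nil_append, List.cons.injEq] at hu
        obtain ⟨rfl, rfl⟩ := hu
        rw [move]
        cases B.kind b
        · exact ⟨[_], rfl⟩
        · exact ⟨[], rfl⟩
        · exact ⟨[], rfl⟩
      · simp only [List.cons_append, List.cons.injEq] at hu
        exact ⟨(B.move e p b g).2 ++ u, by rw [hu.2, List.append_assoc]⟩
    obtain ⟨p', s', h⟩ := foldlM_step_compressor c v w (B.move e p b g).1
      (if B.guess e p g = some b then t + 1 else 0) _
      (o ++ if B.guess e p g = some b then (if t = Fin.last v then [B.bar c, c] else [])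
        else B.codeWord c t b) hu'
    refine ⟨p', s', ?_⟩
    rw [List.append_assoc] at h
    exact h

lemma run_compressor (c : A) (v : ℕ) (w : List A) : ∃ p s, (B.compressor e c v).run w =
    some (((p, ((B.predictor e c v).encode ((none, none), [none]) 0 w).2), s),
      ((B.predictor e c v).encode ((none, none), [none]) 0 w).1) :=
  B.foldlM_step_compressor e c v w (none, none) 0 [none] [] ⟨[], rfl⟩

lemma output_compressor (c : A) (v : ℕ) (w : List A) : (B.compressor e c v).output w =
    ((B.predictor e c v).encode ((none, none), [none]) 0 w).1 := by
  obtain ⟨p, s, h⟩ := B.run_compressor e c v w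
  rw [BPDC.output, h]
  rfl

variable {B} in
lemma isVisiblyPD_compressor {c : A} (hc : B.kind c = SymbolKind.call) (v : ℕ) :
    (B.compressor e c v).IsVisiblyPD := by
  refine ⟨⟨fun w => ?_, fun w w' h => ?_⟩, B.kind, B.compressor_obeysKinds e c v⟩
  · obtain ⟨p, s, h⟩ := B.run_compressor e c v w
    rw [h]
    rfl
  · obtain ⟨p, s, h1⟩ := B.run_compressor e c v w
    obtain ⟨p', s', h2⟩ := B.run_compressor e c v w'
    simp only [h1, h2] at h
    have h := Option.some.inj h
    have h3 := (Prod.mk.inj h).1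
    have h4 : ((B.predictor e c v).encode ((none, none), [none]) 0 w).2 =
      ((B.predictor e c v).encode ((none, none), [none]) 0 w').2 :=
      (Prod.mk.inj (show ((p, _) : Control k × Fin (v + 1)) = (p', _) from (Prod.mk.inj h).2)).2
    exact Predictor.encode_injective (isPrefixFree_predictor e hc v) w w' ((none, none), [none]) 0
      (Prod.ext h3 h4)

/-! ### The compressor on blocks -/

section Blocks

variable {B} {c : A} {v : ℕ}

/-- Every complete block restores the initial control state and stack, so blocks can be added up;
only the count of pending hits is carried over, at bounded cost. -/
lemma length_encode_block {w : List A} (hw : B.Opening w) (t : Fin (v + 1)) :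
    (w ++ B.mirror w).foldl (B.predictor e c v).next ((none, none), [none]) =
      ((none, none), [none]) ∧
    (v + 1) * ((B.predictor e c v).encode ((none, none), [none]) t (w ++ B.mirror w)).1.length ≤
      (v + 3) * w.length + ((v + 1) * (v + 3) + 2 * v) := by
  obtain ⟨x, h1, h2, h3, h4⟩ := foldl_next_opening e (c := c) (v := v) hw none [] (by simp)
  refine ⟨by rw [List.foldl_append, h1, h3], ?_⟩
  rw [Predictor.encode_append, h1, List.length_append]
  have l1 := Predictor.length_encode_of_misses (P := B.predictor e c v) (N := v + 3)
    (fun t b => (B.length_codeWord_le c t b).trans (by have := t.is_le; omega)) w _ t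
    (fun b hb => B.length_codeWord_zero c (hw.kind_ne_ret b hb)) h2
  have l2 := Predictor.length_encode_of_hits (P := B.predictor e c v) rfl (B.mirror w) x
    ((B.predictor e c v).encode ((none, none), [none]) t w).2 h4
  have l3 := ((B.predictor e c v).encode ((none, none), [none]) t w).2.is_le
  rw [length_mirror] at l2
  have l4 := Nat.mul_le_mul_left (v + 1) l1
  nlinarith

lemma length_encode_blocks : ∀ (ws : List (List A)) (t : Fin (v + 1)), (∀ w ∈ ws, B.Opening w) →
    (v + 1) * ((B.predictor e c v).encode ((none, none), [none]) t
      (ws.flatMap fun w => w ++ B.mirror w)).1.length ≤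
    (v + 3) * (ws.map List.length).sum + ws.length * ((v + 1) * (v + 3) + 2 * v)
  | [], t, _ => by simp [Predictor.encode]
  | w :: ws, t, h => by
    obtain ⟨h1, h2⟩ := length_encode_block e (c := c) (v := v) (h w List.mem_cons_self) t
    have ih := length_encode_blocks ws
      ((B.predictor e c v).encode ((none, none), [none]) t (w ++ B.mirror w)).2
      fun w hw => h w (List.mem_cons_of_mem _ hw)
    rw [List.flatMap_cons, Predictor.encode_append, h1, List.length_append, List.map_cons,
      List.sum_cons, List.length_cons]
    linarith

end Blocks

end Brackets

/-! ### Terse words are rare -/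

lemma eventually_polylog_le (d : ℕ) {δ : ℝ} (hδ : 0 < δ) :
    ∀ᶠ j : ℕ in Filter.atTop, (((Nat.log 2 (j ^ 4) + 2) ^ d : ℕ) : ℝ) ≤ δ * j := by
  have h8 : (0 : ℝ) < δ / 8 ^ d := by positivity
  have h1 := (Real.isLittleO_pow_log_id_atTop (n := d)).bound h8
  have h2 := tendsto_natCast_atTop_atTop (R := ℝ)
  have h3 := (Real.tendsto_log_atTop.comp h2).eventually_ge_atTop 1
  filter_upwards [h2.eventually h1, h3, Filter.eventually_gt_atTop 0] with j hj1 hj2 hj3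
  simp only [Function.comp_apply] at hj2
  simp only [id, Real.norm_eq_abs] at hj1
  rw [abs_of_nonneg (by positivity), abs_of_nonneg (by positivity)] at hj1
  -- Here 4 / log 2 < 6, and the summand 2 is absorbed once log j ≥ 1; hence the constant 8.
  have hlog : (Nat.log 2 (j ^ 4) : ℝ) ≤ 6 * Real.log j := by
    have h := Real.natLog_le_logb (j ^ 4) 2
    rw [Real.logb] at h
    push_cast at h
    rw [Real.log_pow, le_div_iff₀ (Real.log_pos (by norm_num))] at h
    push_cast at h
    have hl2 := Real.log_two_gt_d9
    nlinarith [(Nat.cast_nonneg (Nat.log 2 (j ^ 4)) : (0 : ℝ) ≤ _)]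
  push_cast
  calc ((Nat.log 2 (j ^ 4) : ℝ) + 2) ^ d ≤ (8 * Real.log j) ^ d := by
        gcongr
        linarith
    _ = 8 ^ d * Real.log j ^ d := mul_pow _ _ _
    _ ≤ 8 ^ d * (δ / 8 ^ d * j) := by gcongr
    _ = δ * j := by field_simp

lemma length_bits_le (n : ℕ) : n.bits.length ≤ Nat.log 2 n + 1 := by
  rw [Nat.size_eq_bits_len, Nat.size_le]
  exact Nat.lt_pow_succ_log_self (by norm_num) n

lemma OnlineTM.ncard_terse_le_pow {A : Type u} [Fintype A] [Nonempty A] {M : OnlineTM A}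
    {f : List A → List A} (hf : M.Computes f) (hinj : Function.Injective f) {d : ℕ}
    (hd : ∀ w x, StateTransition.Reaches (M.step w.length) (M.init w) x →
      x.head < (Nat.log 2 w.length + 2) ^ d) {j T : ℕ} (hT : T ≤ j) :
    (M.terse j T).ncard ≤ (64 * M.numStates ^ 2 * M.numSymbols ^ 2) ^
      ((Nat.log 2 (j ^ 4) + 2) ^ (d + 1)) * Fintype.card A ^ T := by
  -- The exponent d + 1 makes N exceed log₂(j⁴) even for d = 0, so that all polynomial factors are
  -- at most 2^N.
  set N := (Nat.log 2 (j ^ 4) + 2) ^ (d + 1) with hN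
  have hN1 : Nat.log 2 (j ^ 4) + 2 ≤ N := Nat.le_self_pow (by omega) _
  have hj : j ^ 4 + 1 ≤ 2 ^ N :=
    (Nat.lt_pow_succ_log_self (by norm_num) (j ^ 4)).trans_le
      (Nat.pow_le_pow_right (by norm_num) (by omega))
  have h1 := ncard_terse_le (T := T) hf hinj (j := j) (N := N) fun w hw => by
    have hlog := Nat.log_mono_right (b := 2) hw
    refine ⟨by have := length_bits_le w.length; omega, fun x hx => (hd w x hx).trans_le ?_⟩
    calc (Nat.log 2 w.length + 2) ^ d ≤ (Nat.log 2 (j ^ 4) + 2) ^ d :=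
          Nat.pow_le_pow_left (by omega) _
      _ ≤ N := Nat.pow_le_pow_right (by omega) (by omega)
  have hs : M.numStates ≤ M.numStates ^ N := Nat.le_self_pow (by omega) _
  have hNN : N ≤ 2 ^ N := Nat.lt_two_pow_self.le
  have hTN : T + 1 ≤ 2 ^ N := by
    have : j ≤ j ^ 4 := Nat.le_self_pow (by norm_num) _
    omega
  refine h1.trans ?_
  calc (j ^ 4 + 1) * (M.numStates * (N * (M.numSymbols ^ N * N))) ^ 2 *
        ((T + 1) * Fintype.card A ^ T)
      ≤ 2 ^ N * (M.numStates ^ N * (2 ^ N * (M.numSymbols ^ N * 2 ^ N))) ^ 2 *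
        (2 ^ N * Fintype.card A ^ T) := by gcongr
    _ = (2 * (M.numStates * (2 * (M.numSymbols * 2))) ^ 2 * 2) ^ N * Fintype.card A ^ T := by
        simp only [mul_pow, ← pow_mul, mul_comm N 2]
        ring
    _ = _ := by ring_nf

variable {A : Type u} (B : Brackets A)

/-- Words that a machine compresses beyond the ratio `c` in their original or their mirrored form. -/
def compressible (M : OnlineTM A) (c : ℝ) (j : ℕ) : Set (List A) :=
  {w | w ∈ M.terse j ⌊c * j⌋₊ ∨ B.mirror w ∈ M.terse j ⌊c * j⌋₊}

lemma ncard_compressible_le [Fintype A] (M : OnlineTM A) (c : ℝ) (j : ℕ) (W : Set (List A)) :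
    (W ∩ compressible B M c j).ncard ≤ 2 * (M.terse j ⌊c * j⌋₊).ncard := by
  have hfin : (M.terse j ⌊c * j⌋₊).Finite :=
    (List.finite_length_eq A j).subset fun x hx => hx.1
  have hfin' : (B.mirror ⁻¹' M.terse j ⌊c * j⌋₊).Finite := hfin.preimage B.mirror_injective.injOn
  have h1 : (B.mirror ⁻¹' M.terse j ⌊c * j⌋₊).ncard ≤ (M.terse j ⌊c * j⌋₊).ncard :=
    Set.ncard_le_ncard_of_injOn B.mirror (fun _ h => h) B.mirror_injective.injOn hfin
  calc (W ∩ compressible B M c j).ncard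
      ≤ (M.terse j ⌊c * j⌋₊ ∪ B.mirror ⁻¹' M.terse j ⌊c * j⌋₊).ncard :=
        Set.ncard_le_ncard Set.inter_subset_right (hfin.union hfin')
    _ ≤ _ := (Set.ncard_union_le _ _).trans (by omega)

/-- After taking logarithms, log(k/2) exceeds c log k by the gap η. Half of ηj absorbs the
polylogarithmic memory term, the other half the constants. -/
lemma eventually_rare_compressible [Fintype A] (hA : 2 ≤ Fintype.card A) {M : OnlineTM A}
    {f : List A → List A} (hf : M.Computes f) (hinj : Function.Injective f) (hM : M.PolylogSpace)
    {c : ℝ} (hc0 : 0 ≤ c) (hc : c < 1 - 1 / Real.logb 2 (Fintype.card A)) (W : ℕ → Finset (List A))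
    (hW : ∀ n, (2 / 3 : ℝ) * ((Fintype.card A : ℝ) / 2) ^ n ≤ (W n).card) (C : ℕ) :
    ∀ᶠ j in Filter.atTop, ((W j : Set (List A)) ∩ compressible B M c j).ncard * C < (W j).card := by
  obtain ⟨d, hd⟩ := hM
  have : Nonempty A := Fintype.card_pos_iff.1 (by omega)
  set k := Fintype.card A
  have hk : (2 : ℝ) ≤ k := by exact_mod_cast hA
  have hlk : 0 < Real.log k := Real.log_pos (by linarith)
  have hl2 : 0 < Real.log 2 := Real.log_pos (by norm_num)
  have hs : 1 ≤ M.numStates := Fin.pos M.start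
  have hg : 1 ≤ M.numSymbols := Fin.pos M.blank
  set D : ℕ := 64 * M.numStates ^ 2 * M.numSymbols ^ 2
  have hD : 1 ≤ D := Nat.one_le_iff_ne_zero.2 (by positivity)
  have hD' : (1 : ℝ) ≤ D := by exact_mod_cast hD
  have hlD : 0 ≤ Real.log D := Real.log_nonneg hD'
  set η := (1 - 1 / Real.logb 2 k - c) * Real.log k with hη
  have hη0 : 0 < η := mul_pos (by linarith) hlk
  have hη' : Real.log k - Real.log 2 = c * Real.log k + η := by
    rw [hη, Real.logb]
    field_simp
    ring
  have hc1 : c ≤ 1 := by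
    have : 0 < 1 / Real.logb 2 k := one_div_pos.2 (Real.logb_pos (by norm_num) (by linarith))
    linarith
  have e1 := eventually_polylog_le (d + 1) (δ := η / (2 * (Real.log D + 1))) (by positivity)
  have e2 := (tendsto_natCast_atTop_atTop (R := ℝ)).eventually_gt_atTop
    (2 * Real.log (3 * (C + 1)) / η)
  filter_upwards [e1, e2] with j h1 h2
  set N := (Nat.log 2 (j ^ 4) + 2) ^ (d + 1)
  set T := ⌊c * j⌋₊
  have hTj : (T : ℝ) ≤ c * j := Nat.floor_le (by positivity)
  have hT : T ≤ j := by
    have : (T : ℝ) ≤ j := hTj.trans (mul_le_of_le_one_left (by positivity) hc1)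
    exact_mod_cast this
  have b1 := ncard_compressible_le B M c j (W j)
  have b2 := OnlineTM.ncard_terse_le_pow hf hinj hd hT
  have key : (3 * (C + 1) : ℝ) * ((D : ℝ) ^ N * (k : ℝ) ^ T) < ((k : ℝ) / 2) ^ j := by
    rw [← Real.log_lt_log_iff (by positivity) (by positivity), Real.log_mul
      (x := 3 * (C + 1)) (by positivity) (by positivity), Real.log_mul
      (x := (D : ℝ) ^ N) (by positivity) (by positivity), Real.log_pow, Real.log_pow,
      Real.log_pow, Real.log_div (by positivity) (by positivity), hη']
    rw [div_lt_iff₀ hη0] at h2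
    have h3 : (N : ℝ) * Real.log D ≤ η / 2 * j := by
      rw [div_mul_eq_mul_div, le_div_iff₀ (by positivity)] at h1
      nlinarith [(Nat.cast_nonneg N : (0 : ℝ) ≤ N)]
    have h4 := mul_le_mul_of_nonneg_right hTj hlk.le
    nlinarith
  have b3 : ((W j : Set (List A)) ∩ compressible B M c j).ncard * C ≤ 2 * (D ^ N * k ^ T) * C :=
    Nat.mul_le_mul_right _ (b1.trans (Nat.mul_le_mul_left _ b2))
  have b4 : ((2 * (D ^ N * k ^ T) * C : ℕ) : ℝ) < (W j).card := by
    refine lt_of_lt_of_le ?_ (hW j)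
    push_cast
    have : (0 : ℝ) ≤ (D : ℝ) ^ N * (k : ℝ) ^ T := by positivity
    nlinarith
  exact lt_of_le_of_lt b3 (by exact_mod_cast b4)

/-! ### Countability of the machines -/

instance : Finite Move :=
  Finite.of_injective (fun m => match m with | .left => (0 : Fin 3) | .stay => 1 | .right => 2)
    (by rintro (_ | _ | _) (_ | _ | _) h <;> simp_all)

instance [Finite A] (k g : ℕ) : Finite (Action A k g) :=
  Finite.of_injective
    (fun a : Action A k g => (a.next, a.write, a.workMove, a.lenMove, a.advance, a.emit))
    (by rintro ⟨⟩ ⟨⟩ h; simp_all)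

instance [Finite A] : Countable (OnlineTM A) :=
  have (p : ℕ × ℕ) : Finite (Fin p.1 × Fin p.2 × (Fin p.1 → Option A → Option Bool → Fin p.2 →
      Option (Action A p.1 p.2))) := inferInstance
  have (p : ℕ × ℕ) : Countable (Fin p.1 × Fin p.2 × (Fin p.1 → Option A → Option Bool → Fin p.2 →
      Option (Action A p.1 p.2))) := Finite.to_countable
  Function.Injective.countable
    (f := fun M : OnlineTM A => (⟨(M.numStates, M.numSymbols), M.start, M.blank, M.δ⟩ :
      Σ p : ℕ × ℕ, Fin p.1 × Fin p.2 × (Fin p.1 → Option A → Option Bool → Fin p.2 →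
        Option (Action A p.1 p.2))))
    (by
      rintro ⟨k, g, s, b, d⟩ ⟨k', g', s', b', d'⟩ h
      simp only [Sigma.mk.injEq, Prod.mk.injEq] at h
      obtain ⟨⟨rfl, rfl⟩, h⟩ := h
      simp_all)

/-- There are opening words of all lengths, almost all of which are incompressible for any given
machine. -/
lemma exists_incompressible [Fintype A] (hA : 2 ≤ Fintype.card A) (W : ℕ → Finset (List A))
    (hW : ∀ n, (2 / 3 : ℝ) * ((Fintype.card A : ℝ) / 2) ^ n ≤ (W n).card) :
    ∃ w : ℕ → List A, (∀ n, w n ∈ W n) ∧ ∀ (M : OnlineTM A) (f : List A → List A) (c : ℚ),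
      M.Computes f → Function.Injective f → M.PolylogSpace → 0 ≤ c →
      (c : ℝ) < 1 - 1 / Real.logb 2 (Fintype.card A) →
      ∀ᶠ n in Filter.atTop, w n ∉ compressible B M c n := by
  -- Rational ratios keep the index set countable.
  obtain ⟨w, h1, h2⟩ := exists_eventually_not_mem
    (ι := {p : OnlineTM A × ℚ // (∃ f, p.1.Computes f ∧ Function.Injective f) ∧
      p.1.PolylogSpace ∧ 0 ≤ p.2 ∧ (p.2 : ℝ) < 1 - 1 / Real.logb 2 (Fintype.card A)}) W
    (fun n => by
      have hA' : (0 : ℝ) < Fintype.card A := by exact_mod_cast (by omega : 0 < Fintype.card A)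
      have : (0 : ℝ) < (W n).card := lt_of_lt_of_le (by positivity) (hW n)
      exact Finset.card_pos.1 (by exact_mod_cast this))
    (fun p n => compressible B p.1.1 p.1.2 n)
    (by
      rintro ⟨⟨M, c⟩, ⟨f, hf, hinj⟩, hM, hc0, hc⟩ C
      exact eventually_rare_compressible B hA hf hinj hM (by exact_mod_cast hc0) hc W hW C)
  exact ⟨w, h1, fun M f c hf hinj hM hc0 hc => h2 ⟨(M, c), ⟨f, hf, hinj⟩, hM, hc0, hc⟩⟩

/-! ### The sequence -/

/-- The concatenation of the first `i` words and their mirrored forms. -/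
def blocks (w : ℕ → List A) (i : ℕ) : List A :=
  ((List.range i).map w).flatMap fun x => x ++ B.mirror x

/-- The concatenation of all words and their mirrored forms. -/
def mirrorSeq (a : A) (w : ℕ → List A) (n : ℕ) : A := (blocks B w (n + 2)).getD n a

variable {B} {w : ℕ → List A}

lemma blocks_succ (i : ℕ) : blocks B w (i + 1) = blocks B w i ++ (w i ++ B.mirror (w i)) := by
  simp [blocks, List.range_succ]

lemma blocks_prefix {i j : ℕ} (h : i ≤ j) : blocks B w i <+: blocks B w j := by
  induction j, h using Nat.le_induction with
  | base => exact List.prefix_rfl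
  | succ j _ ih =>
    rw [blocks_succ]
    exact ih.trans (List.prefix_append _ _)

lemma length_blocks (hw : ∀ n, (w n).length = n) (i : ℕ) :
    (blocks B w (i + 1)).length = i * (i + 1) := by
  induction i with
  | zero => simp [blocks, hw]
  | succ i ih =>
    rw [blocks_succ, List.length_append, ih, List.length_append, Brackets.length_mirror, hw]
    ring

lemma pre_mirrorSeq (hw : ∀ n, (w n).length = n) (a : A) {n i : ℕ}
    (hn : n ≤ (blocks B w i).length) : pre (mirrorSeq B a w) n = (blocks B w i).take n := by
  refine List.ext_getElem (by simp [pre, hn]) fun m h1 h2 => ?_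
  have hm : m < n := by simpa [pre] using h1
  -- This is m < (m + 1)(m + 2), so the default letter of `mirrorSeq` is never used.
  have hm2 : m < (blocks B w (m + 2)).length := by
    rw [length_blocks hw]
    nlinarith
  simp only [pre, List.getElem_map, List.getElem_range, mirrorSeq, List.getElem_take,
    List.getD_eq_getElem _ _ hm2]
  rcases le_total i (m + 2) with h | h
  · exact ((blocks_prefix h).getElem (hm.trans_le hn)).symm
  · exact (blocks_prefix h).getElem hm2

lemma length_take_range_sum (hw : ∀ n, (w n).length = n) (i : ℕ) :
    2 * (((List.range (i + 1)).map w).map List.length).sum = i * (i + 1) := by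
  rw [List.map_map]
  induction i with
  | zero => simp [hw]
  | succ i ih =>
    rw [List.range_succ, List.map_append, List.sum_append, Nat.mul_add, ih]
    simp only [List.map_cons, List.map_nil, Function.comp_apply, hw, List.sum_cons, List.sum_nil]
    ring

/-! ### Compression ratios of the sequence -/

lemma div_le_ofReal {l n : ℕ} {x : ℝ} (hn : 0 < n) (h : (l : ℝ) ≤ x * n) :
    (l : ℝ≥0∞) / (n : ℝ≥0∞) ≤ ENNReal.ofReal x := by
  have hn' : (0 : ℝ) < n := by exact_mod_cast hn
  rw [← ENNReal.ofReal_natCast l, ← ENNReal.ofReal_natCast n, ← ENNReal.ofReal_div_of_pos hn']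
  exact ENNReal.ofReal_le_ofReal ((div_le_iff₀ hn').2 h)

lemma ofReal_le_div {l n : ℕ} {x : ℝ} (hn : 0 < n) (h : x * n ≤ l) :
    ENNReal.ofReal x ≤ (l : ℝ≥0∞) / (n : ℝ≥0∞) := by
  have hn' : (0 : ℝ) < n := by exact_mod_cast hn
  rw [← ENNReal.ofReal_natCast l, ← ENNReal.ofReal_natCast n, ← ENNReal.ofReal_div_of_pos hn']
  exact ENNReal.ofReal_le_ofReal ((le_div_iff₀ hn').2 h)

lemma eventually_le_sqrt (K : ℕ) : ∀ᶠ n in Filter.atTop, K ≤ Nat.sqrt n := by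
  filter_upwards [Filter.eventually_ge_atTop (K * K)] with n hn
  exact Nat.le_sqrt.2 hn

/-- The prefix is extended to complete blocks, which can only lengthen the output. The extension and
the overhead per block are O(√n), as about √n blocks cover n letters; the slack between v + 3 and v
+ 5 absorbs them. -/
lemma upperRatio_compressor_le [DecidableEq A] {k : ℕ} (e : A ≃ Fin k) (c : A) (v : ℕ)
    (hw : ∀ n, (w n).length = n) (hop : ∀ n, B.Opening (w n)) (a : A) :
    upperRatio (B.compressor e c v).output (mirrorSeq B a w) ≤
      ENNReal.ofReal (1 / 2 + 2 / (v + 1)) := by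
  set K := (v + 1) * (v + 3) + 2 * v with hK
  refine Filter.limsup_le_of_le (by isBoundedDefault) ?_
  filter_upwards [eventually_le_sqrt (5 * (v + 3) + 6 * K)] with n hn
  set r := Nat.sqrt n
  have hr1 : r * r ≤ n := Nat.sqrt_le n
  have hr2 : n < (r + 1) * (r + 1) := Nat.lt_succ_sqrt n
  have hlen := length_blocks (B := B) hw (r + 1)
  have hnl : n ≤ (blocks B w (r + 1 + 1)).length := by
    rw [hlen]
    nlinarith
  obtain ⟨s, hs⟩ : ∃ s, blocks B w (r + 1 + 1) = pre (mirrorSeq B a w) n ++ s :=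
    ⟨(blocks B w (r + 1 + 1)).drop n, by rw [pre_mirrorSeq hw a hnl, List.take_append_drop]⟩
  have hle := Brackets.length_encode_blocks (B := B) e (c := c) (v := v)
    ((List.range (r + 1 + 1)).map w) 0 (by simp [hop])
  change _ * (Predictor.encode _ _ _ (blocks B w (r + 1 + 1))).1.length ≤ _ at hle
  rw [hs, Predictor.encode_append, ← Brackets.output_compressor, List.length_append,
    List.length_map, List.length_range, ← hK] at hle
  have hsum := length_take_range_sum hw (r + 1)
  set l := ((B.compressor e c v).output (pre (mirrorSeq B a w) n)).length
  set σ := (((List.range (r + 1 + 1)).map w).map List.length).sum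
  have hl : 2 * (v + 1) * l ≤ (v + 3) * ((r + 1) * (r + 1 + 1)) + 2 * (r + 1 + 1) * K := by
    rw [← hsum]
    nlinarith
  have hl2 : 2 * (v + 1) * l ≤ (v + 5) * n := by
    have : (5 * (v + 3) + 6 * K) * r ≤ r * r := Nat.mul_le_mul_right _ hn
    have hr : 1 ≤ r := by omega
    have h6 : (v + 3) * ((r + 1) * (r + 1 + 1)) + 2 * (r + 1 + 1) * K ≤
        (v + 3) * (r * r) + (5 * (v + 3) + 6 * K) * r := by
      have : K ≤ K * r := Nat.le_mul_of_pos_right _ hr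
      have : v + 3 ≤ (v + 3) * r := Nat.le_mul_of_pos_right _ hr
      nlinarith
    nlinarith
  have hn0 : 0 < n := by
    have : 1 ≤ r := by omega
    nlinarith
  refine div_le_ofReal hn0 ?_
  have hl3 : (2 * (v + 1) * l : ℝ) ≤ (v + 5) * n := by exact_mod_cast hl2
  have : (1 / 2 + 2 / ((v : ℝ) + 1)) * n = (v + 5) * n / (2 * (v + 1)) := by
    field_simp
    ring
  rw [this, le_div_iff₀ (by positivity)]
  linarith

lemma RVisiblyPD_mirrorSeq_le [Finite A] {c : A} (hc : B.kind c = SymbolKind.call)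
    (hw : ∀ n, (w n).length = n) (hop : ∀ n, B.Opening (w n)) (a : A) :
    RVisiblyPD (mirrorSeq B a w) ≤ 1 / 2 := by
  classical
  obtain ⟨k, ⟨e⟩⟩ := Finite.exists_equiv_fin A
  have hv : ∀ v : ℕ, RVisiblyPD (mirrorSeq B a w) ≤ ENNReal.ofReal (1 / 2 + 2 / (v + 1)) :=
    fun v => iInf_le_of_le ⟨B.compressor e c v, Brackets.isVisiblyPD_compressor e hc v⟩
      (upperRatio_compressor_le e c v hw hop a)
  have hlim : Filter.Tendsto (fun v : ℕ => ENNReal.ofReal (1 / 2 + 2 / (v + 1))) Filter.atTop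
      (nhds (1 / 2)) := by
    have h1 : Filter.Tendsto (fun v : ℕ => (1 / 2 + 2 * (1 / ((v : ℝ) + 1)))) Filter.atTop
        (nhds (1 / 2 + 2 * 0)) :=
      tendsto_const_nhds.add (tendsto_one_div_add_atTop_nhds_zero_nat.const_mul 2)
    have h2 := ENNReal.tendsto_ofReal h1
    have h3 : ENNReal.ofReal (1 / 2 + 2 * 0) = 1 / 2 := by
      rw [mul_zero, add_zero, ENNReal.ofReal_div_of_pos (by norm_num)]
      simp
    rw [h3] at h2
    simpa only [mul_one_div] using h2
  exact ge_of_tendsto' hlim hv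

lemma flatten_pairs (ws : List (List A)) :
    (ws.flatMap fun x => [x, B.mirror x]).flatten = ws.flatMap fun x => x ++ B.mirror x := by
  induction ws with
  | nil => rfl
  | cons x ws ih => simp [ih]

lemma sum_pairs (hw : ∀ n, (w n).length = n) (c s : ℝ) (r : ℕ) :
    ((((List.range r).map w).flatMap fun x => [x, B.mirror x]).map
      fun b => c * ((b.length : ℝ) - s)).sum = c * (r * (r - 1) - 2 * s * r) := by
  induction r with
  | zero => simp
  | succ r ih =>
    rw [List.range_succ, List.map_append, List.flatMap_append, List.map_append, List.sum_append, ih]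
    simp only [List.map_cons, List.map_nil, List.flatMap_cons, List.flatMap_nil, List.append_nil,
      Brackets.length_mirror, hw, List.sum_cons, List.sum_nil]
    push_cast
    ring

/-- With r = ⌊√n⌋ and s = ⌊√r⌋, a block half longer than s has length j with n ≤ j⁴, as `terse`
requires, and costs more than cj letters. Ignoring the shorter halves and the incomplete end loses
O(rs), that is O(n^(3/4)), which the gap between c' and c absorbs. -/
lemma le_lowerRatio_mirrorSeq [Nontrivial A] (hw : ∀ n, (w n).length = n) (a : A) {M : OnlineTM A}
    {f : List A → List A} (hf : M.Computes f) (hinj : Function.Injective f) {c c' : ℝ} (hc0 : 0 ≤ c)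
    (hcc : c' < c) (hbad : ∀ᶠ n in Filter.atTop, w n ∉ compressible B M c n) :
    ENNReal.ofReal c' ≤ lowerRatio f (mirrorSeq B a w) := by
  obtain ⟨J, hJ⟩ := Filter.eventually_atTop.1 hbad
  obtain ⟨K, hK⟩ := exists_nat_ge (5 * c / (c - c'))
  refine Filter.le_liminf_of_le (by isBoundedDefault) ?_
  filter_upwards [eventually_le_sqrt ((J + K + 1) * (J + K + 1))] with n hn
  set r := Nat.sqrt n
  set s := Nat.sqrt r
  have hr1 : r * r ≤ n := Nat.sqrt_le n
  have hr2 : n < (r + 1) * (r + 1) := Nat.lt_succ_sqrt n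
  have hs1 : s * s ≤ r := Nat.sqrt_le r
  have hs2 : r < (s + 1) * (s + 1) := Nat.lt_succ_sqrt r
  have hs3 : J + K + 1 ≤ s := Nat.le_sqrt.2 hn
  have hr0 : 1 ≤ r := by nlinarith
  have hn0 : 0 < n := by nlinarith
  have hn4 : ∀ j, s < j → n ≤ j ^ 4 := by
    intro j hj
    have h1 : r + 1 ≤ j * j := by nlinarith
    have h2 : (r + 1) * (r + 1) ≤ (j * j) * (j * j) := Nat.mul_le_mul h1 h1
    nlinarith
  have hlen : (blocks B w r).length + 1 ≤ n := by
    obtain ⟨i, hi⟩ : ∃ i, r = i + 1 := ⟨r - 1, by omega⟩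
    rw [hi, length_blocks hw]
    rw [hi] at hr1
    nlinarith
  have hnl : n ≤ (blocks B w (r + 1 + 1)).length := by
    rw [length_blocks hw]
    nlinarith
  obtain ⟨v, hv⟩ : blocks B w r <+: pre (mirrorSeq B a w) n := by
    rw [pre_mirrorSeq hw a hnl, List.prefix_take_iff]
    exact ⟨blocks_prefix (by omega), by omega⟩
  have hpn : (pre (mirrorSeq B a w) n).length = n := by simp [pre]
  obtain ⟨Y, hY1, hY2, hY3⟩ := hf (pre (mirrorSeq B a w) n)
  -- The last letter may remain unread, so at least one letter is kept behind the complete blocks.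
  have hY4 := hf.length_input_le_one hinj hY1 hY2
  have hvl : 1 ≤ v.length := by
    have := congrArg List.length hv
    rw [List.length_append, hpn] at this
    omega
  rw [hpn, ← hv, OnlineTM.init_eq, blocks, ← flatten_pairs] at hY1
  -- Subtracting s makes the bound trivial for short halves and keeps the sum explicit.
  have hout := OnlineTM.sum_le_length_output (n := n) (fun b => c * ((b.length : ℝ) - s))
    (hY4.trans hvl) _ [] [] M.initCore (.nil _)
    (by
      rw [flatten_pairs]
      change 0 + (blocks B w r).length ≤ n
      omega) hY1
    (by
      intro b hb u c₀ o₀ c₁ o hu h₀ h₁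
      rcases le_or_gt b.length s with hbs | hbs
      · have : (b.length : ℝ) ≤ s := by exact_mod_cast hbs
        exact (mul_nonpos_of_nonneg_of_nonpos hc0 (by linarith)).trans (Nat.cast_nonneg _)
      · have hterse : b ∉ M.terse b.length ⌊c * b.length⌋₊ := by
          simp only [List.mem_flatMap, List.mem_map, List.mem_range, List.mem_cons,
            List.not_mem_nil, or_false] at hb
          obtain ⟨_, ⟨i, _, rfl⟩, rfl | rfl⟩ := hb
          · rw [hw] at hbs ⊢
            exact fun h => hJ i (by omega) (Or.inl h)
          · rw [Brackets.length_mirror, hw] at hbs ⊢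
            exact fun h => hJ i (by omega) (Or.inr h)
        have ho : ⌊c * b.length⌋₊ < o.length := by
          by_contra! ho
          exact hterse ⟨rfl, n, u, c₀, o₀, c₁, o, hn4 _ hbs, hu, h₀, h₁, ho⟩
        have h2 := (Nat.floor_lt' (by omega)).1 ho
        have : (0 : ℝ) ≤ s := by positivity
        nlinarith)
  rw [sum_pairs hw, hY3] at hout
  refine ofReal_le_div hn0 ?_
  have hcK : 5 * c ≤ (c - c') * s := by
    have h1 : (K : ℝ) ≤ s := by exact_mod_cast (by omega : K ≤ s)
    have := (div_le_iff₀ (sub_pos.2 hcc)).1 (hK.trans h1)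
    linarith
  have hs0 : (1 : ℝ) ≤ s := by exact_mod_cast (by omega : 1 ≤ s)
  have hsr : (s : ℝ) * s ≤ r := by exact_mod_cast hs1
  have hrn : (r : ℝ) * r ≤ n := by exact_mod_cast hr1
  have hnr : (n : ℝ) ≤ r * r + 2 * r := by
    have : n ≤ r * r + 2 * r := by nlinarith
    exact_mod_cast this
  have hr0' : (0 : ℝ) ≤ r := by positivity
  have h1 : c * (3 + 2 * s) ≤ (c - c') * r := by
    have h2 : c * (3 + 2 * s) ≤ 5 * c * s := by nlinarith
    have h3 : 5 * c * s ≤ (c - c') * s * s := by nlinarith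
    have h4 : (c - c') * (s * s) ≤ (c - c') * r := by
      exact mul_le_mul_of_nonneg_left hsr (by linarith)
    linarith
  have h5 : c * (3 + 2 * s) * r ≤ (c - c') * n :=
    calc c * (3 + 2 * s) * r ≤ (c - c') * r * r := by gcongr
      _ = (c - c') * (r * r) := by ring
      _ ≤ _ := mul_le_mul_of_nonneg_left hrn (by linarith)
  have h6 : c * n ≤ c * (r * r + 2 * r) := by gcongr
  simp only [List.length_nil, Nat.cast_zero, zero_add] at hout
  linarith

end Compression

theorem theorem4 {A : Type*} [Fintype A] (hA : 2 ≤ Fintype.card A) :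
    ∃ S : ℕ → A,
      Compression.RVisiblyPD S ≤ 1 / 2 ∧
      ENNReal.ofReal (1 - 1 / Real.logb 2 (Fintype.card A : ℝ)) ≤ Compression.rhoPlogon S := by
  obtain ⟨B, W, ⟨a, ha⟩, hW, hcard⟩ := Compression.Brackets.exists_many_openings hA
  obtain ⟨w, hw, hbad⟩ := Compression.exists_incompressible B hA W hcard
  have : Nontrivial A := Fintype.one_lt_card_iff_nontrivial.1 hA
  have hlen : ∀ n, (w n).length = n := fun n => (hW n _ (hw n)).2
  refine ⟨Compression.mirrorSeq B a w,
    Compression.RVisiblyPD_mirrorSeq_le ha hlen (fun n => (hW n _ (hw n)).1) a, le_iInf ?_⟩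
  rintro ⟨f, hinj, M, hM, hf⟩
  refine le_of_forall_lt fun x hx => ?_
  obtain ⟨q, _, hxq, hq⟩ := ENNReal.lt_iff_exists_rat_btwn.1 hx
  have hq' : (q : ℝ) < 1 - 1 / Real.logb 2 (Fintype.card A : ℝ) := by
    rw [← ENNReal.ofReal, ENNReal.ofReal_lt_ofReal_iff'] at hq
    exact hq.1
  -- A second rational c leaves room between q and the ratio for which the words are incompressible.
  obtain ⟨c, hc1, hc2⟩ := exists_rat_btwn hq'
  have hc0 : 0 ≤ c := by
    have : q ≤ c := by exact_mod_cast hc1.le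
    linarith
  exact hxq.trans_le (Compression.le_lowerRatio_mirrorSeq hlen a hf hinj (by exact_mod_cast hc0) hc1
    (hbad M f c hf hinj hM hc0 hc2))
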